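/- Let $S$ be a set of $n \ge 4$ points in the plane in general position, meaning that no three points of $S$ are collinear and no four points of $S$ are cocircular. For $1 \le k \le n-1$, the order-$k$ Voronoi diagram of $S$ is the subdivision of the plane into the cells $$V(T) = \{x \in \mathbb{R}^2 : |x-a| \le |x-b| \text{ for all } a \in T,\ b \in S \setminus T\},$$ where $T$ ranges over the $k$-element subsets of $S$; its vertices are the points that lie in at least three of these cells. Let $v_k$ be the number of vertices of the order-$k$ Voronoi diagram of $S$, and let $p_V(z) = \sum_{k=1}^{n-1} v_k z^{k-1}$ be the Voronoi polynomial of $S$. Then $S$ is in convex position (that is, no point of $S$ lies in the convex hull of the other points of $S$) if and only if every complex root of $p_V$ lies on the unit circle $|z| = 1$. -/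

import Mathlib

noncomputable section

namespace VoronoiPoly

/-- The Euclidean plane. -/
abbrev Plane : Type := EuclideanSpace ℝ (Fin 2)

/-- No three points of `S` are collinear and no four points of `S` are cocircular. -/
def GeneralPosition (S : Finset Plane) : Prop :=
  (∀ T : Finset Plane, T ⊆ S → T.card = 3 → ¬ Collinear ℝ (T : Set Plane)) ∧
  (∀ T : Finset Plane, T ⊆ S → T.card = 4 → ¬ EuclideanGeometry.Cospherical (T : Set Plane))

/-- Every point of `S` is outside the convex hull of the other points of `S`. -/
def ConvexPosition (S : Finset Plane) : Prop :=
  ConvexIndependent ℝ (fun x : (S : Set Plane) => (x : Plane))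

/-- The closed Voronoi cell of `T ⊆ S`: the points of the plane for which the points of `T` are
`T.card` nearest points of `S`. -/
def voronoiCell (S T : Finset Plane) : Set Plane :=
  {x | ∀ a ∈ T, ∀ b ∈ S, b ∉ T → dist x a ≤ dist x b}

/-- The vertices of the order-`k` Voronoi diagram of `S`: the points of the plane at which at
least three cells of the diagram meet. -/
def voronoiVertices (S : Finset Plane) (k : ℕ) : Set Plane :=
  {x | 3 ≤ {T : Finset Plane | T ⊆ S ∧ T.card = k ∧ x ∈ voronoiCell S T}.ncard}

/-- The number `v_k` of vertices of the order-`k` Voronoi diagram of `S`. (Every vertex is the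
circumcenter of three points of `S`, so there are finitely many.) -/
def numVoronoiVertices (S : Finset Plane) (k : ℕ) : ℕ :=
  (voronoiVertices S k).ncard

/-- The Voronoi polynomial `∑_{k=1}^{n-1} v_k z^{k-1}` of `S`, where `n = S.card`. -/
def voronoiPolynomial (S : Finset Plane) : Polynomial ℂ :=
  ∑ k ∈ Finset.Icc 1 (S.card - 1),
    Polynomial.C (numVoronoiVertices S k : ℂ) * Polynomial.X ^ (k - 1)

end VoronoiPoly

end

/-! Let `n` be the number of points, `c_j` the number of circles through three points with exactly
`j` points strictly inside, and `h` the number of points lying in the hull of the others. A point is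
a vertex of the order-`k` diagram exactly when it is the centre of a circle counted by `c_{k-1}` or
`c_{k-2}`. Hence `p_V = (1 + z) * ∑ c_j z^j` (`voronoiPolynomial_eq`), and since the extra root `-1`
is harmless, only the second factor matters.

The end coefficients detect convexity: `c_0 = n - 2 + h` and `c_{n-3} = n - 2 - h`
(`circleCount_zero_and_top`). Charge each triple to its middle point `p` in a generic direction and
invert at `p`. Circles through `p` become lines, and an empty circle or one enclosing everything
else becomes the upper or lower bridge of the inverted set across an axis. The side on which a
bridge passes the origin decides which kind it is; both are empty if `p` is hidden, and otherwise
there is one of each. If all roots have modulus 1, Vieta gives `c_0 = c_{n-3}`, so `h = 0`.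

Conversely, in convex position deleting a point preserves `h = 0`, and double counting over
deletions yields `c_j = (j + 1)(n - 2 - j)` by induction (`circleCount_of_hiddenPoints_eq_empty`).
On the unit circle the resulting polynomial is a unimodular factor times a real cosine sum.
Multiplied by a suitable sine, that sum has an explicit primitive with equal values at successive
zeros of the sine, so Rolle produces as many roots on the circle as the degree allows
(`norm_eq_one_of_isRoot_convexCirclePoly`). -/

noncomputable section

namespace VoronoiPoly

/-! ### Circles and determinants -/

/-- The squared distance of two points of the plane, in coordinates. -/
def sqDist (p q : Plane) : ℝ := (q 0 - p 0) ^ 2 + (q 1 - p 1) ^ 2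

/-- Twice the signed area of the triangle `p q r`. -/
def orient (p q r : Plane) : ℝ :=
  (q 0 - p 0) * (r 1 - p 1) - (r 0 - p 0) * (q 1 - p 1)

/-- The in-circle determinant of four points. -/
def inCircle (p q r s : Plane) : ℝ :=
  sqDist p q * orient p r s - sqDist p r * orient p q s + sqDist p s * orient p q r

/-- `s` lies strictly inside a circle through the points of `T`. -/
def Encloses (T : Finset Plane) (s : Plane) : Prop :=
  ∃ (x : Plane) (r : ℝ), (∀ a ∈ T, dist x a = r) ∧ dist x s < r

lemma dist_sq_eq (p q : Plane) : dist p q ^ 2 = sqDist p q := by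
  rw [EuclideanSpace.dist_eq, Real.sq_sqrt (by positivity)]
  simp only [Fin.sum_univ_two, Real.dist_eq, sq_abs, sqDist]
  ring

lemma dist_eq_dist_iff (x a b : Plane) : dist x a = dist x b ↔ sqDist x a = sqDist x b := by
  rw [← dist_sq_eq, ← dist_sq_eq]
  exact (pow_left_inj₀ dist_nonneg dist_nonneg two_ne_zero).symm

lemma dist_lt_dist_iff (x a b : Plane) : dist x a < dist x b ↔ sqDist x a < sqDist x b := by
  rw [← dist_sq_eq, ← dist_sq_eq]
  exact (pow_lt_pow_iff_left₀ dist_nonneg dist_nonneg two_ne_zero).symm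

lemma sqDist_pos {p q : Plane} (h : q ≠ p) : 0 < sqDist p q := by
  rw [← dist_sq_eq]
  exact pow_pos (dist_pos.2 h.symm) 2

lemma collinear_of_orient_eq_zero {p q r : Plane} (hpq : p ≠ q) (h : orient p q r = 0) :
    Collinear ℝ ({p, q, r} : Set Plane) := by
  rw [collinear_iff_of_mem (p₀ := p) (by simp)]
  have hN := sqDist_pos hpq.symm
  refine ⟨q - p, ?_⟩
  rintro x (rfl | rfl | rfl)
  · exact ⟨0, by simp⟩
  · exact ⟨1, by simp⟩
  · refine ⟨((q 0 - p 0) * (x 0 - p 0) + (q 1 - p 1) * (x 1 - p 1)) / sqDist p q, ?_⟩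
    have h' : (q 0 - p 0) * (x 1 - p 1) = (x 0 - p 0) * (q 1 - p 1) := by
      unfold orient at h; linarith
    ext i
    fin_cases i
    · simp only [Fin.zero_eta, vadd_eq_add, PiLp.add_apply, PiLp.smul_apply, PiLp.sub_apply,
        smul_eq_mul]
      rw [div_mul_eq_mul_div, ← sub_eq_iff_eq_add, eq_div_iff hN.ne']
      unfold sqDist
      linear_combination (-(q 1 - p 1)) * h'
    · simp only [Fin.mk_one, vadd_eq_add, PiLp.add_apply, PiLp.smul_apply, PiLp.sub_apply,
        smul_eq_mul]
      rw [div_mul_eq_mul_div, ← sub_eq_iff_eq_add, eq_div_iff hN.ne']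
      unfold sqDist
      linear_combination (q 0 - p 0) * h'

lemma exists_circumcenter {p q r : Plane} (h : orient p q r ≠ 0) :
    ∃ x : Plane, dist x q = dist x p ∧ dist x r = dist x p := by
  -- Cramer's rule for the linear system `2 (x - p) · (q - p) = sqDist p q`, `2 (x - p) · (r - p) =
  -- sqDist p r`.
  refine ⟨!₂[p 0 + (sqDist p q * (r 1 - p 1) - sqDist p r * (q 1 - p 1)) / (2 * orient p q r),
    p 1 + (sqDist p r * (q 0 - p 0) - sqDist p q * (r 0 - p 0)) / (2 * orient p q r)], ?_, ?_⟩
  all_goals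
    rw [dist_eq_dist_iff]
    simp only [sqDist, Matrix.cons_val_zero, Matrix.cons_val_one]
    field_simp
    unfold orient
    ring

/-- The power of `s` with respect to the circle through `p`, `q`, `r`. -/
lemma orient_mul_power {x p q r : Plane} (s : Plane) (hq : dist x q = dist x p)
    (hr : dist x r = dist x p) :
    orient p q r * (sqDist x s - sqDist x p) = inCircle p q r s := by
  rw [dist_eq_dist_iff] at hq hr
  unfold inCircle orient
  unfold sqDist at *
  linear_combination (-((r 0 - p 0) * (s 1 - p 1) - (s 0 - p 0) * (r 1 - p 1))) * hq +
    (((q 0 - p 0) * (s 1 - p 1) - (s 0 - p 0) * (q 1 - p 1))) * hr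

/-- The power of `s` is determined by `p`, `q`, `r`, so the existentially quantified circle in
`Encloses` may be replaced by any given one. -/
lemma encloses_iff_of_dist_eq {x p q r s : Plane} (h : orient p q r ≠ 0)
    (hq : dist x q = dist x p) (hr : dist x r = dist x p) :
    Encloses {p, q, r} s ↔ dist x s < dist x p := by
  constructor
  · rintro ⟨y, ρ, hy, hs⟩
    have hp' := hy p (by simp)
    have hq' := hy q (by simp)
    have hr' := hy r (by simp)
    have e1 := orient_mul_power s hq hr
    have e2 := orient_mul_power s (hq'.trans hp'.symm) (hr'.trans hp'.symm)
    rw [← hp', dist_lt_dist_iff] at hs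
    rw [dist_lt_dist_iff]
    have := mul_left_cancel₀ h (e1.trans e2.symm)
    linarith
  · intro hs
    refine ⟨x, dist x p, ?_, hs⟩
    simp [hq, hr]

lemma encloses_iff {p q r s : Plane} (h : orient p q r ≠ 0) :
    Encloses {p, q, r} s ↔ orient p q r * inCircle p q r s < 0 := by
  obtain ⟨x, hq, hr⟩ := exists_circumcenter h
  rw [encloses_iff_of_dist_eq h hq hr, ← orient_mul_power s hq hr, dist_lt_dist_iff, ← mul_assoc]
  have : 0 < orient p q r * orient p q r := mul_self_pos.2 h
  rw [mul_neg_iff]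
  constructor
  · intro h'; exact Or.inl ⟨this, by linarith⟩
  · rintro (h' | h') <;> linarith [h'.1, h'.2]

lemma circumcenter_unique {x y p q r : Plane} (h : orient p q r ≠ 0)
    (hq : dist x q = dist x p) (hr : dist x r = dist x p)
    (hq' : dist y q = dist y p) (hr' : dist y r = dist y p) : x = y := by
  rw [dist_eq_dist_iff] at hq hr hq' hr'
  unfold sqDist at *
  ext i
  fin_cases i
  · apply mul_left_cancel₀ h
    unfold orient
    simp only [Fin.zero_eta]
    linear_combination (1/2) * ((r 1 - p 1) * (hq' - hq) - (q 1 - p 1) * (hr' - hr))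
  · apply mul_left_cancel₀ h
    unfold orient
    simp only [Fin.mk_one]
    linear_combination (1/2) * ((q 0 - p 0) * (hr' - hr) - (r 0 - p 0) * (hq' - hq))

namespace GeneralPosition

variable {S : Finset Plane}

lemma mono (hS : GeneralPosition S) {S' : Finset Plane} (h : S' ⊆ S) : GeneralPosition S' :=
  ⟨fun T hT => hS.1 T (hT.trans h), fun T hT => hS.2 T (hT.trans h)⟩

lemma orient_ne_zero (hS : GeneralPosition S) {p q r : Plane} (hp : p ∈ S) (hq : q ∈ S)
    (hr : r ∈ S) (hpq : p ≠ q) (hpr : p ≠ r) (hqr : q ≠ r) : orient p q r ≠ 0 := by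
  classical
  intro h
  refine hS.1 {p, q, r} ?_ (Finset.card_eq_three.2 ⟨p, q, r, hpq, hpr, hqr, rfl⟩) ?_
  · simp [Finset.insert_subset_iff, hp, hq, hr]
  · simpa using collinear_of_orient_eq_zero hpq h

lemma inCircle_ne_zero (hS : GeneralPosition S) {p q r s : Plane} (hp : p ∈ S) (hq : q ∈ S)
    (hr : r ∈ S) (hs : s ∈ S) (hpq : p ≠ q) (hpr : p ≠ r) (hqr : q ≠ r) (hps : p ≠ s)
    (hqs : q ≠ s) (hrs : r ≠ s) : inCircle p q r s ≠ 0 := by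
  classical
  intro h
  have ho := hS.orient_ne_zero hp hq hr hpq hpr hqr
  obtain ⟨x, hxq, hxr⟩ := exists_circumcenter ho
  have hpow := orient_mul_power s hxq hxr
  rw [h] at hpow
  have hxs : dist x s = dist x p := by
    rw [dist_eq_dist_iff]
    have := (mul_eq_zero.1 hpow).resolve_left ho
    linarith
  refine hS.2 {p, q, r, s} ?_ (Finset.card_eq_four.2 ⟨p, q, r, s, hpq, hpr, hps, hqr, hqs, hrs, rfl⟩)
    ⟨x, dist x p, ?_⟩
  · simp [Finset.insert_subset_iff, hp, hq, hr, hs]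
  · simp [dist_comm _ x, hxq, hxr, hxs]

lemma card_filter_dist_le_three (hS : GeneralPosition S) (x : Plane) (ρ : ℝ) :
    (S.filter fun s => dist x s = ρ).card ≤ 3 := by
  by_contra! h
  obtain ⟨T, hT, hc⟩ := Finset.exists_subset_card_eq (Nat.succ_le_of_lt h)
  refine hS.2 T (hT.trans (Finset.filter_subset _ _)) hc ⟨x, ρ, fun s hs => ?_⟩
  rw [dist_comm]
  exact (Finset.mem_filter.1 (hT hs)).2

end GeneralPosition

/-! ### Bridges of a planar set across the vertical axis -/

section Bridge

variable {ι : Type*} (X Y : ι → ℝ)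

/-- Twice the signed area of the triangle with vertices `(X i, Y i)`, `i = q, r, s`. -/
def signedArea (q r s : ι) : ℝ := (X r - X q) * (Y s - Y q) - (X s - X q) * (Y r - Y q)

/-- The height at which the line through the points `q` and `r` meets the vertical axis. -/
def crossing (q r : ι) : ℝ := (Y q * X r - Y r * X q) / (X r - X q)

variable {X Y}

/-- The signed area relative to `q'`, `r'` is affine, so its value where the line `q r` meets the
axis is the weighted mean of its values at `q` and `r`; dividing by `X r' - X q'` turns it into a
height difference. -/
lemma crossing_sub_crossing {q r q' r' : ι} (h : X r - X q ≠ 0) (h' : X r' - X q' ≠ 0) :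
    crossing X Y q r - crossing X Y q' r' =
      (signedArea X Y q' r' q * X r + signedArea X Y q' r' r * (-X q)) /
        ((X r' - X q') * (X r - X q)) := by
  unfold crossing signedArea
  field_simp
  ring

/-- A finite set of points on both sides of the vertical axis has an upper bridge. -/
lemma exists_upper_bridge {A : Finset ι} (hX : ∀ i ∈ A, X i ≠ 0) (hneg : ∃ i ∈ A, X i < 0)
    (hpos : ∃ i ∈ A, 0 < X i)
    (hA : ∀ i ∈ A, ∀ j ∈ A, ∀ k ∈ A, i ≠ j → i ≠ k → j ≠ k → signedArea X Y i j k ≠ 0) :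
    ∃ q ∈ A, ∃ r ∈ A, X q < 0 ∧ 0 < X r ∧
      (∀ s ∈ A, s ≠ q → s ≠ r → signedArea X Y q r s < 0) ∧
      ∀ q' ∈ A, ∀ r' ∈ A, X q' < 0 → 0 < X r' → crossing X Y q' r' ≤ crossing X Y q r := by
  classical
  obtain ⟨i, hi, hi'⟩ := hneg
  obtain ⟨j, hj, hj'⟩ := hpos
  obtain ⟨⟨q, r⟩, hmem, hmax⟩ := Finset.exists_max_image
    ((A ×ˢ A).filter fun t => X t.1 < 0 ∧ 0 < X t.2) (fun t => crossing X Y t.1 t.2)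
    ⟨(i, j), by simp [hi, hj, hi', hj']⟩
  simp only [Finset.mem_filter, Finset.mem_product] at hmem
  obtain ⟨⟨hq, hr⟩, hq', hr'⟩ := hmem
  have hmax' : ∀ q' ∈ A, ∀ r' ∈ A, X q' < 0 → 0 < X r' → crossing X Y q' r' ≤ crossing X Y q r :=
    fun a ha b hb h1 h2 => hmax (a, b) (by simp [ha, hb, h1, h2])
  refine ⟨q, hq, r, hr, hq', hr', fun s hs hsq hsr => ?_, hmax'⟩
  have hqr : q ≠ r := by rintro rfl; linarith
  by_contra! hcon
  have hO : 0 < signedArea X Y q r s :=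
    lt_of_le_of_ne hcon (hA q hq r hr s hs hqr hsq.symm hsr.symm).symm
  have h0 : 0 < X r - X q := by linarith
  -- A point above the maximal chord could replace the endpoint on its own side and raise the
  -- crossing.
  rcases lt_or_gt_of_ne (hX s hs) with hs' | hs'
  · have h1 : 0 < X r - X s := by linarith
    have hle := hmax' s hs r hr hs' hr'
    have heq := crossing_sub_crossing (Y := Y) h1.ne' h0.ne'
    have hz : signedArea X Y q r r = 0 := by unfold signedArea; ring
    rw [hz, zero_mul, add_zero] at heq
    have : 0 < signedArea X Y q r s * X r / ((X r - X q) * (X r - X s)) := by positivity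
    linarith
  · have h1 : 0 < X s - X q := by linarith
    have hle := hmax' q hq s hs hq' hs'
    have heq := crossing_sub_crossing (Y := Y) h1.ne' h0.ne'
    have hz : signedArea X Y q r q = 0 := by unfold signedArea; ring
    rw [hz, zero_mul, zero_add] at heq
    have : 0 < signedArea X Y q r s * (-X q) / ((X r - X q) * (X s - X q)) :=
      div_pos (mul_pos hO (by linarith)) (mul_pos h0 h1)
    linarith

/-- No point lies above the line of the bridge `(q', r')`, so a chord with a different endpoint
would cross the axis strictly lower, against `hle`. -/
lemma upper_bridge_unique {A : Finset ι} {q r q' r' : ι} (hq : q ∈ A) (hr : r ∈ A)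
    (hXq : X q < 0) (hXr : 0 < X r) (hXq' : X q' < 0) (hXr' : 0 < X r')
    (hle : crossing X Y q' r' ≤ crossing X Y q r)
    (hbr : ∀ s ∈ A, s ≠ q' → s ≠ r' → signedArea X Y q' r' s < 0) : q = q' ∧ r = r' := by
  have h0 : 0 < X r - X q := by linarith
  have h0' : 0 < X r' - X q' := by linarith
  have heq := crossing_sub_crossing (Y := Y) h0.ne' h0'.ne'
  have hnum : 0 ≤ signedArea X Y q' r' q * X r + signedArea X Y q' r' r * (-X q) := by
    by_contra! h
    have := div_neg_of_neg_of_pos h (mul_pos h0' h0)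
    linarith
  have hqr' : q ≠ r' := by rintro rfl; linarith
  have hrq' : r ≠ q' := by rintro rfl; linarith
  have hz : signedArea X Y q' r' q' = 0 := by unfold signedArea; ring
  have hz' : signedArea X Y q' r' r' = 0 := by unfold signedArea; ring
  by_cases h1 : q = q'
  · by_cases h2 : r = r'
    · exact ⟨h1, h2⟩
    · have := hbr r hr hrq' h2
      subst h1
      rw [hz] at hnum
      nlinarith
  · have hq1 := hbr q hq h1 hqr'
    have hr1 : signedArea X Y q' r' r ≤ 0 := by
      by_cases h2 : r = r'
      · rw [h2, hz']
      · exact (hbr r hr hrq' h2).le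
    nlinarith

end Bridge

/-! ### Inversion at a point -/

/-- A linear functional, in coordinates, applied to `s - p`. -/
def slant (ε : ℝ) (p s : Plane) : ℝ := (s 0 - p 0) + ε * (s 1 - p 1)

lemma notMem_convexHull_of_linear {A : Set Plane} {p : Plane} (a b : ℝ)
    (h : ∀ s ∈ A, a * (s 0 - p 0) + b * (s 1 - p 1) < 0) : p ∉ convexHull ℝ A := by
  intro hp
  have hconv : Convex ℝ {x : Plane | a * (x 0 - p 0) + b * (x 1 - p 1) < 0} := by
    intro x hx y hy u v hu hv huv
    simp only [Set.mem_ofPred_eq, PiLp.add_apply, PiLp.smul_apply, smul_eq_mul] at hx hy ⊢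
    have e : a * (u * x 0 + v * y 0 - p 0) + b * (u * x 1 + v * y 1 - p 1) =
        u * (a * (x 0 - p 0) + b * (x 1 - p 1)) + v * (a * (y 0 - p 0) + b * (y 1 - p 1)) := by
      linear_combination (a * p 0 + b * p 1) * huv
    rw [e]
    rcases hu.eq_or_lt with rfl | hu'
    · have : v = 1 := by linarith
      subst this; linarith
    · nlinarith [mul_neg_of_pos_of_neg hu' hx, mul_nonpos_of_nonneg_of_nonpos hv hy.le]
  have := convexHull_min (t := {x : Plane | a * (x 0 - p 0) + b * (x 1 - p 1) < 0}) h hconv hp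
  simp at this

/-- The two chords meet the line `slant ε p = 0` on opposite sides of `p`, so `p` lies between two
points of the hull. -/
lemma mem_convexHull_of_crossings {A : Set Plane} {p q r q' r' : Plane} {ε : ℝ}
    (hq : q ∈ A) (hr : r ∈ A) (hq' : q' ∈ A) (hr' : r' ∈ A)
    (h1 : slant ε p q < 0) (h2 : 0 < slant ε p r) (h1' : slant ε p q' < 0)
    (h2' : 0 < slant ε p r') (ho : orient p q r < 0) (ho' : 0 < orient p q' r') :
    p ∈ convexHull ℝ A := by
  have hc := convex_convexHull ℝ A
  have hd : 0 < slant ε p r - slant ε p q := by linarith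
  have hd' : 0 < slant ε p r' - slant ε p q' := by linarith
  have hz := hc (subset_convexHull ℝ A hq) (subset_convexHull ℝ A hr)
    (a := slant ε p r / (slant ε p r - slant ε p q))
    (b := -slant ε p q / (slant ε p r - slant ε p q)) (by positivity)
    (div_nonneg (by linarith) hd.le) (by field_simp; ring)
  have hz' := hc (subset_convexHull ℝ A hq') (subset_convexHull ℝ A hr')
    (a := slant ε p r' / (slant ε p r' - slant ε p q'))
    (b := -slant ε p q' / (slant ε p r' - slant ε p q')) (by positivity)
    (div_nonneg (by linarith) hd'.le) (by field_simp; ring)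
  -- `t` and `-t'` are the second coordinates, relative to `p`, of the two crossing points.
  set t := -orient p q r / (slant ε p r - slant ε p q) with ht
  set t' := orient p q' r' / (slant ε p r' - slant ε p q') with ht'
  have htpos : 0 < t := div_pos (by linarith) hd
  have htpos' : 0 < t' := div_pos ho' hd'
  have hfin := hc hz hz' (a := t' / (t + t')) (b := t / (t + t')) (by positivity) (by positivity)
    (by field_simp; ring)
  have hs : t + t' ≠ 0 := by positivity
  convert hfin using 1
  have c1 : slant ε p r / (slant ε p r - slant ε p q) * (q 1 - p 1) +
      -slant ε p q / (slant ε p r - slant ε p q) * (r 1 - p 1) = t := by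
    rw [ht]; field_simp; unfold slant orient; ring
  have c1' : slant ε p r' / (slant ε p r' - slant ε p q') * (q' 1 - p 1) +
      -slant ε p q' / (slant ε p r' - slant ε p q') * (r' 1 - p 1) = -t' := by
    rw [ht']; field_simp; unfold slant orient; ring
  have c0 : slant ε p r / (slant ε p r - slant ε p q) * (q 0 - p 0) +
      -slant ε p q / (slant ε p r - slant ε p q) * (r 0 - p 0) = -ε * t := by
    rw [ht]; field_simp; unfold slant orient; ring
  have c0' : slant ε p r' / (slant ε p r' - slant ε p q') * (q' 0 - p 0) +
      -slant ε p q' / (slant ε p r' - slant ε p q') * (r' 0 - p 0) = ε * t' := by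
    rw [ht']; field_simp; unfold slant orient; ring
  have s1 : slant ε p r / (slant ε p r - slant ε p q) +
      -slant ε p q / (slant ε p r - slant ε p q) = 1 := by field_simp; ring
  have s1' : slant ε p r' / (slant ε p r' - slant ε p q') +
      -slant ε p q' / (slant ε p r' - slant ε p q') = 1 := by field_simp; ring
  have s2 : t' / (t + t') + t / (t + t') = 1 := by field_simp; ring
  have s3 : t' / (t + t') * t = t / (t + t') * t' := by field_simp
  generalize slant ε p r / (slant ε p r - slant ε p q) = α at *
  generalize -slant ε p q / (slant ε p r - slant ε p q) = β at *
  generalize slant ε p r' / (slant ε p r' - slant ε p q') = α' at *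
  generalize -slant ε p q' / (slant ε p r' - slant ε p q') = β' at *
  generalize t' / (t + t') = γ at *
  generalize t / (t + t') = δ at *
  ext i
  fin_cases i
  · simp only [Fin.zero_eta, PiLp.add_apply, PiLp.smul_apply, smul_eq_mul]
    linear_combination (-γ) * c0 - δ * c0' - γ * p 0 * s1 - δ * p 0 * s1' - p 0 * s2 + ε * s3
  · simp only [Fin.mk_one, PiLp.add_apply, PiLp.smul_apply, smul_eq_mul]
    linear_combination (-γ) * c1 - δ * c1' - γ * p 1 * s1 - δ * p 1 * s1' - p 1 * s2 - s3

/-- Inversion at `p` turns circles through `p` into lines. The shear by `ε` that follows it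
preserves area, so `ε` drops out. -/
lemma signedArea_inversion {ε : ℝ} {p q r s : Plane} (hq : q ≠ p) (hr : r ≠ p) (hs : s ≠ p) :
    signedArea (fun z => slant ε p z / sqDist p z) (fun z => (z 1 - p 1) / sqDist p z) q r s =
      inCircle p q r s / (sqDist p q * sqDist p r * sqDist p s) := by
  have := (sqDist_pos hq).ne'
  have := (sqDist_pos hr).ne'
  have := (sqDist_pos hs).ne'
  unfold signedArea
  field_simp
  unfold inCircle orient slant
  ring

/-- For `q` and `r` on the negative and positive side, the sign of `orient p q r` tells on which
side of the origin, the image of infinity, the inverted chord passes. -/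
lemma crossing_inversion {ε : ℝ} {p q r : Plane} (hq : q ≠ p) (hr : r ≠ p) :
    crossing (fun z => slant ε p z / sqDist p z) (fun z => (z 1 - p 1) / sqDist p z) q r =
      -orient p q r / (sqDist p q * sqDist p r) /
        (slant ε p r / sqDist p r - slant ε p q / sqDist p q) := by
  have := (sqDist_pos hq).ne'
  have := (sqDist_pos hr).ne'
  unfold crossing
  congr 1
  field_simp
  unfold orient slant
  ring

/-- The two facets at `p`: the upper bridge `(q, r)` and the lower bridge `(q', r')` of the
inversion of `S` at `p`. -/
lemma exists_bridges {S : Finset Plane} (hS : GeneralPosition S) {ε : ℝ} {p : Plane} (hp : p ∈ S)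
    (hF : ∀ s ∈ S, s ≠ p → slant ε p s ≠ 0) (hneg : ∃ s ∈ S, slant ε p s < 0)
    (hpos : ∃ s ∈ S, 0 < slant ε p s) :
    ∃ q ∈ S, ∃ r ∈ S, ∃ q' ∈ S, ∃ r' ∈ S,
      slant ε p q < 0 ∧ 0 < slant ε p r ∧ slant ε p q' < 0 ∧ 0 < slant ε p r' ∧
      (∀ a ∈ S, ∀ b ∈ S, slant ε p a < 0 → 0 < slant ε p b →
        ((∀ s ∈ S, s ≠ p → s ≠ a → s ≠ b → inCircle p a b s < 0) ↔ a = q ∧ b = r)) ∧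
      (∀ a ∈ S, ∀ b ∈ S, slant ε p a < 0 → 0 < slant ε p b →
        ((∀ s ∈ S, s ≠ p → s ≠ a → s ≠ b → 0 < inCircle p a b s) ↔ a = q' ∧ b = r')) ∧
      (0 < orient p q r → 0 < orient p q' r') ∧
      (p ∈ convexHull ℝ ((S : Set Plane) \ {p}) ↔ orient p q r < 0 ∧ 0 < orient p q' r') := by
  classical
  set X : Plane → ℝ := fun z => slant ε p z / sqDist p z with hXdef
  set Y : Plane → ℝ := fun z => (z 1 - p 1) / sqDist p z with hYdef
  set A := S.erase p with hAdef
  have hself : slant ε p p = 0 := by simp [slant]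
  have hnp : ∀ s, slant ε p s < 0 → s ≠ p := by rintro s h rfl; linarith
  have hpp : ∀ s, 0 < slant ε p s → s ≠ p := by rintro s h rfl; linarith
  have hXneg : ∀ s, s ≠ p → (X s < 0 ↔ slant ε p s < 0) := fun s hs => by
    rw [div_lt_iff₀ (sqDist_pos hs), zero_mul]
  have hXpos : ∀ s, s ≠ p → (0 < X s ↔ 0 < slant ε p s) := fun s hs =>
    div_pos_iff_of_pos_right (sqDist_pos hs)
  have hX : ∀ i ∈ A, X i ≠ 0 := fun i hi =>
    div_ne_zero (hF i (Finset.mem_of_mem_erase hi) (Finset.ne_of_mem_erase hi))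
      (sqDist_pos (Finset.ne_of_mem_erase hi)).ne'
  have hn : ∃ i ∈ A, X i < 0 := by
    obtain ⟨s, hs, h⟩ := hneg
    exact ⟨s, Finset.mem_erase.2 ⟨hnp s h, hs⟩, (hXneg s (hnp s h)).2 h⟩
  have hpo : ∃ i ∈ A, 0 < X i := by
    obtain ⟨s, hs, h⟩ := hpos
    exact ⟨s, Finset.mem_erase.2 ⟨hpp s h, hs⟩, (hXpos s (hpp s h)).2 h⟩
  have hsa : ∀ i j k, i ≠ p → j ≠ p → k ≠ p → signedArea X Y i j k =
      inCircle p i j k / (sqDist p i * sqDist p j * sqDist p k) :=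
    fun i j k hi hj hk => signedArea_inversion hi hj hk
  have hden : ∀ i j k, i ≠ p → j ≠ p → k ≠ p → 0 < sqDist p i * sqDist p j * sqDist p k :=
    fun i j k hi hj hk => mul_pos (mul_pos (sqDist_pos hi) (sqDist_pos hj)) (sqDist_pos hk)
  have hsaneg : ∀ i j k, i ≠ p → j ≠ p → k ≠ p → (signedArea X Y i j k < 0 ↔ inCircle p i j k < 0) :=
    fun i j k hi hj hk => by
      rw [hsa i j k hi hj hk, div_lt_iff₀ (hden i j k hi hj hk), zero_mul]
  have hsapos : ∀ i j k, i ≠ p → j ≠ p → k ≠ p → (0 < signedArea X Y i j k ↔ 0 < inCircle p i j k) :=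
    fun i j k hi hj hk => by
      rw [hsa i j k hi hj hk]; exact div_pos_iff_of_pos_right (hden i j k hi hj hk)
  have hgen : ∀ i ∈ A, ∀ j ∈ A, ∀ k ∈ A, i ≠ j → i ≠ k → j ≠ k → signedArea X Y i j k ≠ 0 := by
    intro i hi j hj k hk hij hik hjk
    rw [hAdef, Finset.mem_erase] at hi hj hk
    rw [hsa i j k hi.1 hj.1 hk.1]
    exact div_ne_zero (hS.inCircle_ne_zero hp hi.2 hj.2 hk.2 hi.1.symm hj.1.symm hij hk.1.symm hik hjk)
      (hden i j k hi.1 hj.1 hk.1).ne'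
  have hsn : ∀ i j k, signedArea X (fun z => -Y z) i j k = -signedArea X Y i j k := by
    intros; unfold signedArea; ring
  have hcn : ∀ i j, crossing X (fun z => -Y z) i j = -crossing X Y i j := by
    intros; unfold crossing; ring
  obtain ⟨q, hq, r, hr, hq0, hr0, hbr, hmax⟩ := exists_upper_bridge hX hn hpo hgen
  -- The lower bridge is the upper bridge of the set reflected in the horizontal axis.
  obtain ⟨q', hq', r', hr', hq0', hr0', hbr', hmax'⟩ := exists_upper_bridge (Y := fun z => -Y z)
    hX hn hpo (by
      intro i hi j hj k hk hij hik hjk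
      rw [hsn]; exact neg_ne_zero.2 (hgen i hi j hj k hk hij hik hjk))
  have hgu : ∀ q ∈ A, ∀ r ∈ A, X q < 0 → 0 < X r → orient p q r ≠ 0 := by
    intro q hq r hr h1 h2
    have hq := Finset.mem_erase.1 hq
    have hr := Finset.mem_erase.1 hr
    exact hS.orient_ne_zero hp hq.2 hr.2 hq.1.symm hr.1.symm (by rintro rfl; linarith)
  have hou := hgu q hq r hr hq0 hr0
  have hol := hgu q' hq' r' hr' hq0' hr0'
  have hAq := hq; have hAr := hr; have hAq' := hq'; have hAr' := hr'
  rw [hAdef, Finset.mem_erase] at hq hr hq' hr'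
  -- The upper bridge crosses the axis no lower than the lower one; if it passes below the origin,
  -- so does the other.
  have hcomp : 0 < orient p q r → 0 < orient p q' r' := by
    intro h
    by_contra hcon
    have h1 := hmax q' hAq' r' hAr' hq0' hr0'
    have e1 : crossing X Y q r = _ := crossing_inversion hq.1 hr.1
    have e2 : crossing X Y q' r' = _ := crossing_inversion hq'.1 hr'.1
    have a1 : crossing X Y q r < 0 := by
      rw [e1]
      exact div_neg_of_neg_of_pos (div_neg_of_neg_of_pos (by linarith)
        (mul_pos (sqDist_pos hq.1) (sqDist_pos hr.1))) (by simp only [hXdef] at hq0 hr0; linarith)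
    have a2 : 0 ≤ crossing X Y q' r' := by
      rw [e2]
      exact div_nonneg (div_nonneg (by linarith)
        (mul_pos (sqDist_pos hq'.1) (sqDist_pos hr'.1)).le)
        (by simp only [hXdef] at hq0' hr0'; linarith)
    linarith
  refine ⟨q, hq.2, r, hr.2, q', hq'.2, r', hr'.2, (hXneg q hq.1).1 hq0, (hXpos r hr.1).1 hr0,
    (hXneg q' hq'.1).1 hq0', (hXpos r' hr'.1).1 hr0', ?_, ?_, hcomp, ?_, ?_⟩
  · intro a ha b hb ha0 hb0
    have hap := hnp a ha0
    have hbp := hpp b hb0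
    constructor
    · intro h
      obtain ⟨h1, h2⟩ := upper_bridge_unique (Y := Y) hAq hAr hq0 hr0 ((hXneg a hap).2 ha0)
        ((hXpos b hbp).2 hb0) (hmax a (Finset.mem_erase.2 ⟨hap, ha⟩) b
          (Finset.mem_erase.2 ⟨hbp, hb⟩) ((hXneg a hap).2 ha0) ((hXpos b hbp).2 hb0))
        (fun s hs hsa' hsb => by
          have hs := Finset.mem_erase.1 hs
          exact (hsaneg a b s hap hbp hs.1).2 (h s hs.2 hs.1 hsa' hsb))
      exact ⟨h1.symm, h2.symm⟩
    · rintro ⟨rfl, rfl⟩ s hs hsp hsa' hsb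
      exact (hsaneg a b s hap hbp hsp).1 (hbr s (Finset.mem_erase.2 ⟨hsp, hs⟩) hsa' hsb)
  · intro a ha b hb ha0 hb0
    have hap := hnp a ha0
    have hbp := hpp b hb0
    constructor
    · intro h
      obtain ⟨h1, h2⟩ := upper_bridge_unique (Y := fun z => -Y z) hAq' hAr' hq0' hr0'
        ((hXneg a hap).2 ha0)
        ((hXpos b hbp).2 hb0) (hmax' a (Finset.mem_erase.2 ⟨hap, ha⟩) b
          (Finset.mem_erase.2 ⟨hbp, hb⟩) ((hXneg a hap).2 ha0) ((hXpos b hbp).2 hb0))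
        (fun s hs hsa' hsb => by
          have hs := Finset.mem_erase.1 hs
          rw [hsn, neg_lt_zero]
          exact (hsapos a b s hap hbp hs.1).2 (h s hs.2 hs.1 hsa' hsb))
      exact ⟨h1.symm, h2.symm⟩
    · rintro ⟨rfl, rfl⟩ s hs hsp hsa' hsb
      have := hbr' s (Finset.mem_erase.2 ⟨hsp, hs⟩) hsa' hsb
      rw [hsn, neg_lt_zero] at this
      exact (hsapos a b s hap hbp hsp).1 this
  · intro hmem
    -- As a function of `s`, the determinant is a linear form in `s - p` plus `sqDist p s * orient p
    -- a b`. If a bridge passes the origin on the wrong side, this linear form strictly separates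
    -- `p` from the other points.
    have hz : ∀ a b s, inCircle p a b s =
        (sqDist p b * (a 1 - p 1) - sqDist p a * (b 1 - p 1)) * (s 0 - p 0) +
        (sqDist p a * (b 0 - p 0) - sqDist p b * (a 0 - p 0)) * (s 1 - p 1) +
        sqDist p s * orient p a b := by
      intros; unfold inCircle orient; ring
    have hz1 : ∀ a b, inCircle p a b a = 0 := by intros; unfold inCircle orient; ring
    have hz2 : ∀ a b, inCircle p a b b = 0 := by intros; unfold inCircle orient; ring
    constructor
    · by_contra hcon
      have ho : 0 < orient p q r := lt_of_le_of_ne (not_lt.1 hcon) hou.symm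
      refine notMem_convexHull_of_linear (sqDist p r * (q 1 - p 1) - sqDist p q * (r 1 - p 1))
        (sqDist p q * (r 0 - p 0) - sqDist p r * (q 0 - p 0)) ?_ hmem
      rintro s ⟨hs, hsp⟩
      have hle : inCircle p q r s ≤ 0 := by
        by_cases h1 : s = q
        · rw [h1, hz1]
        by_cases h2 : s = r
        · rw [h2, hz2]
        exact ((hsaneg q r s hq.1 hr.1 hsp).1 (hbr s (Finset.mem_erase.2 ⟨hsp, hs⟩) h1 h2)).le
      rw [hz] at hle
      have := mul_pos (sqDist_pos hsp) ho
      linarith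
    · by_contra hcon
      have ho : orient p q' r' < 0 := lt_of_le_of_ne (not_lt.1 hcon) hol
      refine notMem_convexHull_of_linear
        (-(sqDist p r' * (q' 1 - p 1) - sqDist p q' * (r' 1 - p 1)))
        (-(sqDist p q' * (r' 0 - p 0) - sqDist p r' * (q' 0 - p 0))) ?_ hmem
      rintro s ⟨hs, hsp⟩
      have hle : 0 ≤ inCircle p q' r' s := by
        by_cases h1 : s = q'
        · rw [h1, hz1]
        by_cases h2 : s = r'
        · rw [h2, hz2]
        have := hbr' s (Finset.mem_erase.2 ⟨hsp, hs⟩) h1 h2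
        rw [hsn, neg_lt_zero] at this
        exact ((hsapos q' r' s hq'.1 hr'.1 hsp).1 this).le
      rw [hz] at hle
      have := mul_pos (sqDist_pos hsp) (neg_pos.2 ho)
      linarith
  · rintro ⟨h1, h2⟩
    exact mem_convexHull_of_crossings (ε := ε) ⟨hq.2, hq.1⟩ ⟨hr.2, hr.1⟩ ⟨hq'.2, hq'.1⟩
      ⟨hr'.2, hr'.1⟩ ((hXneg q hq.1).1 hq0) ((hXpos r hr.1).1 hr0) ((hXneg q' hq'.1).1 hq0')
      ((hXpos r' hr'.1).1 hr0') h1 h2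

/-! ### Counting empty and full circles -/

open scoped Classical in
/-- The number of points of `S` strictly inside the circle through the points of `T`. -/
def insideCount (S T : Finset Plane) : ℕ := (S.filter fun s => Encloses T s).card

/-- The number of circles through three points of `S` with exactly `j` points of `S` inside. -/
def circleCount (S : Finset Plane) (j : ℕ) : ℕ :=
  ((S.powersetCard 3).filter fun T => insideCount S T = j).card

lemma not_encloses_of_mem {T : Finset Plane} {s : Plane} (hs : s ∈ T) : ¬ Encloses T s := by
  rintro ⟨x, r, h, h'⟩
  exact h'.ne (h s hs)

open scoped Classical in
lemma insideCount_eq_zero_iff {S T : Finset Plane} :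
    insideCount S T = 0 ↔ ∀ s ∈ S, s ∉ T → ¬ Encloses T s := by
  rw [insideCount, Finset.card_eq_zero, Finset.filter_eq_empty_iff]
  exact ⟨fun h s hs _ => h hs, fun h s hs => by
    by_cases hT : s ∈ T
    · exact not_encloses_of_mem hT
    · exact h s hs hT⟩

open scoped Classical in
lemma insideCount_le {S T : Finset Plane} (hT : T ⊆ S) : insideCount S T ≤ S.card - T.card := by
  rw [insideCount, ← Finset.card_sdiff_of_subset hT]
  refine Finset.card_le_card fun s hs => ?_
  rw [Finset.mem_filter] at hs
  exact Finset.mem_sdiff.2 ⟨hs.1, fun h => not_encloses_of_mem h hs.2⟩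

open scoped Classical in
lemma insideCount_eq_iff {S T : Finset Plane} (hT : T ⊆ S) :
    insideCount S T = S.card - T.card ↔ ∀ s ∈ S, s ∉ T → Encloses T s := by
  have hsub : (S.filter fun s => Encloses T s) ⊆ S \ T := fun s hs => by
    rw [Finset.mem_filter] at hs
    exact Finset.mem_sdiff.2 ⟨hs.1, fun h => not_encloses_of_mem h hs.2⟩
  rw [← Finset.card_sdiff_of_subset hT]
  constructor
  · intro h s hs hsT
    have : s ∈ S.filter fun s => Encloses T s := by
      rw [Finset.eq_of_subset_of_card_le hsub h.ge]
      exact Finset.mem_sdiff.2 ⟨hs, hsT⟩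
    exact (Finset.mem_filter.1 this).2
  · intro h
    unfold insideCount
    congr 1
    ext s
    simp only [Finset.mem_filter, Finset.mem_sdiff]
    exact ⟨fun h' => ⟨h'.1, fun hh => not_encloses_of_mem hh h'.2⟩, fun h' => ⟨h'.1, h s h'.1 h'.2⟩⟩

/-- Each pair of distinct points rules out at most one `ε`. -/
lemma exists_generic_slant (S : Finset Plane) :
    ∃ ε : ℝ, ∀ p ∈ S, ∀ q ∈ S, q ≠ p → slant ε p q ≠ 0 := by
  have hfin : (⋃ t ∈ (S ×ˢ S).filter (fun t => t.2 ≠ t.1),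
      {ε : ℝ | slant ε t.1 t.2 = 0}).Finite := by
    refine Set.Finite.biUnion (Finset.finite_toSet _) fun t ht => ?_
    have ht := (Finset.mem_filter.1 ht).2
    refine Set.Subsingleton.finite fun a ha b hb => ?_
    simp only [slant, Set.mem_ofPred_eq] at ha hb
    by_contra hab
    have h1 : t.2 1 - t.1 1 = 0 := by
      have : (a - b) * (t.2 1 - t.1 1) = 0 := by linarith
      exact (mul_eq_zero.1 this).resolve_left (sub_ne_zero.2 hab)
    have h0 : t.2 0 - t.1 0 = 0 := by rw [h1] at ha; linarith
    apply ht
    ext i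
    fin_cases i
    · simp only [Fin.zero_eta]; linarith
    · simp only [Fin.mk_one]; linarith
  obtain ⟨ε, hε⟩ := hfin.infinite_compl.nonempty
  refine ⟨ε, fun p hp q hq hqp h => hε ?_⟩
  simp only [Set.mem_iUnion]
  exact ⟨(p, q), by simp [hp, hq, hqp], h⟩

lemma slant_eq_sub (ε : ℝ) (p q : Plane) : slant ε p q = (q 0 + ε * q 1) - (p 0 + ε * p 1) := by
  unfold slant; ring

open scoped Classical in
/-- The pairs of points of `S` on different sides of `p`, such that the triple has property `P`. -/
def pairsAt (S : Finset Plane) (ε : ℝ) (P : Finset Plane → Prop) (p : Plane) :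
    Finset (Plane × Plane) :=
  (S ×ˢ S).filter fun t => slant ε p t.1 < 0 ∧ 0 < slant ε p t.2 ∧ P {p, t.1, t.2}

open scoped Classical in
/-- Every triple has a unique middle point. -/
lemma card_filter_powersetCard_three {S : Finset Plane} {ε : ℝ}
    (hε : ∀ p ∈ S, ∀ q ∈ S, q ≠ p → slant ε p q ≠ 0) (P : Finset Plane → Prop) :
    ((S.powersetCard 3).filter P).card = ∑ p ∈ S, (pairsAt S ε P p).card := by
  rw [← Finset.card_sigma]
  symm
  have hinj : ∀ p ∈ S, ∀ q ∈ S, slant ε p q = 0 → p = q := fun p hp q hq h => by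
    by_contra hne
    exact hε p hp q hq (Ne.symm hne) h
  refine Finset.card_bij (fun t _ => {t.1, t.2.1, t.2.2}) ?_ ?_ ?_
  · rintro ⟨p, q, r⟩ h
    simp only [Finset.mem_sigma, pairsAt, Finset.mem_filter, Finset.mem_product] at h
    obtain ⟨hp, ⟨hq, hr⟩, h1, h2, h3⟩ := h
    simp only [Finset.mem_filter, Finset.mem_powersetCard]
    refine ⟨⟨by simp [Finset.insert_subset_iff, hp, hq, hr], Finset.card_eq_three.2
      ⟨p, q, r, ?_, ?_, ?_, rfl⟩⟩, h3⟩
    · rintro rfl; simp [slant] at h1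
    · rintro rfl; simp [slant] at h2
    · rintro rfl; linarith
  · rintro ⟨p, q, r⟩ h ⟨p', q', r'⟩ h' heq
    simp only [Finset.mem_sigma, pairsAt, Finset.mem_filter, Finset.mem_product] at h h'
    obtain ⟨hp, ⟨hq, hr⟩, h1, h2, -⟩ := h
    obtain ⟨hp', ⟨hq', hr'⟩, h1', h2', -⟩ := h'
    simp only at heq
    rw [slant_eq_sub] at h1 h2 h1' h2'
    have m1 : p ∈ ({p', q', r'} : Finset Plane) := by rw [← heq]; simp
    have m2 : q ∈ ({p', q', r'} : Finset Plane) := by rw [← heq]; simp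
    have m3 : r ∈ ({p', q', r'} : Finset Plane) := by rw [← heq]; simp
    have m2' : q' ∈ ({p, q, r} : Finset Plane) := by rw [heq]; simp
    have m3' : r' ∈ ({p, q, r} : Finset Plane) := by rw [heq]; simp
    simp only [Finset.mem_insert, Finset.mem_singleton] at m1 m2 m3 m2' m3'
    have hqq : q = q' := by
      apply hinj q hq q' hq'
      rw [slant_eq_sub]
      apply le_antisymm
      · rcases m2 with rfl | rfl | rfl <;> linarith
      · rcases m2' with rfl | rfl | rfl <;> linarith
    have hrr : r = r' := by
      apply hinj r hr r' hr'
      rw [slant_eq_sub]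
      apply le_antisymm
      · rcases m3' with rfl | rfl | rfl <;> linarith
      · rcases m3 with rfl | rfl | rfl <;> linarith
    subst hqq hrr
    rcases m1 with rfl | rfl | rfl
    · rfl
    · linarith
    · linarith
  · intro T hT
    simp only [Finset.mem_filter, Finset.mem_powersetCard] at hT
    obtain ⟨⟨hTS, hT3⟩, hPT⟩ := hT
    obtain ⟨a, b, c, hab, hac, hbc, rfl⟩ := Finset.card_eq_three.1 hT3
    have ha : a ∈ S := hTS (by simp)
    have hb : b ∈ S := hTS (by simp)
    have hc : c ∈ S := hTS (by simp)
    have key : ∀ x ∈ S, ∀ y ∈ S, ∀ z ∈ S, slant ε y x < 0 → 0 < slant ε y z →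
        ({a, b, c} : Finset Plane) = {y, x, z} → ∃ t, ∃ (_ : t ∈ S.sigma (pairsAt S ε P)),
          ({t.1, t.2.1, t.2.2} : Finset Plane) = {a, b, c} := by
      intro x hx y hy z hz h1 h2 h3
      refine ⟨⟨y, x, z⟩, ?_, h3.symm⟩
      simp only [Finset.mem_sigma, pairsAt, Finset.mem_filter, Finset.mem_product]
      exact ⟨hy, ⟨hx, hz⟩, h1, h2, h3 ▸ hPT⟩
    have nab := hε a ha b hb hab.symm
    have nac := hε a ha c hc hac.symm
    have nbc := hε b hb c hc hbc.symm
    have sab : slant ε a b = - slant ε b a := by unfold slant; ring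
    have sac : slant ε a c = - slant ε c a := by unfold slant; ring
    have sbc : slant ε b c = - slant ε c b := by unfold slant; ring
    have tri : slant ε a c = slant ε a b + slant ε b c := by unfold slant; ring
    rcases lt_or_gt_of_ne nab with h1 | h1 <;> rcases lt_or_gt_of_ne nac with h2 | h2 <;>
      rcases lt_or_gt_of_ne nbc with h3 | h3
    · exact key c hc b hb a ha h3 (by linarith) (by ext; simp; tauto)
    · exact key b hb c hc a ha (by linarith) (by linarith) (by ext; simp; tauto)
    · linarith
    · exact key b hb a ha c hc (by linarith) (by linarith) rfl
    · exact key c hc a ha b hb (by linarith) (by linarith) (by ext; simp; tauto)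
    · linarith
    · exact key a ha c hc b hb (by linarith) (by linarith) (by ext; simp; tauto)
    · exact key a ha b hb c hc (by linarith) (by linarith) (by ext; simp; tauto)

section Counts

variable {S : Finset Plane} {ε : ℝ} {p : Plane}

-- Only the two bridges can give a circle that is empty or encloses all other points, and the sign
-- of `orient` decides between these. Hidden means both empty; both full is impossible; otherwise
-- there is one of each.
open scoped Classical in
lemma card_pairsAt (hn : 4 ≤ S.card) (hS : GeneralPosition S) (hp : p ∈ S)
    (hF : ∀ s ∈ S, s ≠ p → slant ε p s ≠ 0) (hneg : ∃ s ∈ S, slant ε p s < 0)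
    (hpos : ∃ s ∈ S, 0 < slant ε p s) :
    (pairsAt S ε (fun T => insideCount S T = 0) p).card =
        1 + (if p ∈ convexHull ℝ ((S : Set Plane) \ {p}) then 1 else 0) ∧
    (pairsAt S ε (fun T => insideCount S T = S.card - 3) p).card +
        (if p ∈ convexHull ℝ ((S : Set Plane) \ {p}) then 1 else 0) = 1 := by
  obtain ⟨q, hq, r, hr, q', hq', r', hr', hq0, hr0, hq0', hr0', hU, hW, hcomp, hconv⟩ :=
    exists_bridges hS hp hF hneg hpos
  have horient : ∀ a ∈ S, ∀ b ∈ S, slant ε p a < 0 → 0 < slant ε p b →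
      p ≠ a ∧ p ≠ b ∧ a ≠ b ∧ orient p a b ≠ 0 := by
    intro a ha b hb h1 h2
    have e1 : p ≠ a := by rintro rfl; simp [slant] at h1
    have e2 : p ≠ b := by rintro rfl; simp [slant] at h2
    have e3 : a ≠ b := by rintro rfl; linarith
    exact ⟨e1, e2, e3, hS.orient_ne_zero hp ha hb e1 e2 e3⟩
  have hinc : ∀ a ∈ S, ∀ b ∈ S, slant ε p a < 0 → 0 < slant ε p b → ∀ s ∈ S, s ≠ p → s ≠ a →
      s ≠ b → inCircle p a b s ≠ 0 := by
    intro a ha b hb h1 h2 s hs hsp hsa hsb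
    obtain ⟨e1, e2, e3, -⟩ := horient a ha b hb h1 h2
    exact hS.inCircle_ne_zero hp ha hb hs e1 e2 e3 hsp.symm hsa.symm hsb.symm
  -- The fourth point is what makes the upper and lower bridges different: it cannot lie on both
  -- sides of the same line.
  have hex : ∀ a b, ∃ s ∈ S, s ≠ p ∧ s ≠ a ∧ s ≠ b := by
    intro a b
    have hc : ({p, a, b} : Finset Plane).card < S.card := lt_of_le_of_lt Finset.card_le_three (by omega)
    obtain ⟨s, hs, hs'⟩ := Finset.exists_mem_notMem_of_card_lt_card hc
    simp only [Finset.mem_insert, Finset.mem_singleton, not_or] at hs'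
    exact ⟨s, hs, hs'.1, hs'.2.1, hs'.2.2⟩
  have hne : (q, r) ≠ (q', r') := by
    intro h
    obtain ⟨rfl, rfl⟩ := Prod.mk.inj h
    obtain ⟨s, hs, h1, h2, h3⟩ := hex q r
    have l1 := (hU q hq r hr hq0 hr0).2 ⟨rfl, rfl⟩ s hs h1 h2 h3
    have l2 := (hW q hq r hr hq0 hr0).2 ⟨rfl, rfl⟩ s hs h1 h2 h3
    linarith
  have hE : ∀ a ∈ S, ∀ b ∈ S, slant ε p a < 0 → 0 < slant ε p b →
      (insideCount S {p, a, b} = 0 ↔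
        (a = q ∧ b = r ∧ orient p q r < 0) ∨ (a = q' ∧ b = r' ∧ 0 < orient p q' r')) := by
    intro a ha b hb h1 h2
    obtain ⟨e1, e2, e3, e4⟩ := horient a ha b hb h1 h2
    rw [insideCount_eq_zero_iff]
    simp only [encloses_iff e4, Finset.mem_insert, Finset.mem_singleton, not_or]
    constructor
    · intro h
      rcases lt_or_gt_of_ne e4 with h5 | h5
      · left
        obtain ⟨rfl, rfl⟩ := (hU a ha b hb h1 h2).1 fun s hs hsp hsa hsb => by
          refine lt_of_le_of_ne ?_ (hinc a ha b hb h1 h2 s hs hsp hsa hsb)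
          by_contra! hcon
          exact h s hs ⟨hsp, hsa, hsb⟩ (mul_neg_of_neg_of_pos h5 hcon)
        exact ⟨rfl, rfl, h5⟩
      · right
        obtain ⟨rfl, rfl⟩ := (hW a ha b hb h1 h2).1 fun s hs hsp hsa hsb => by
          refine lt_of_le_of_ne ?_ (hinc a ha b hb h1 h2 s hs hsp hsa hsb).symm
          by_contra! hcon
          exact h s hs ⟨hsp, hsa, hsb⟩ (mul_neg_of_pos_of_neg h5 hcon)
        exact ⟨rfl, rfl, h5⟩
    · rintro (⟨rfl, rfl, h5⟩ | ⟨rfl, rfl, h5⟩) s hs ⟨hsp, hsa, hsb⟩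
      · exact (mul_pos_of_neg_of_neg h5 ((hU a ha b hb h1 h2).2 ⟨rfl, rfl⟩ s hs hsp hsa hsb)).not_gt
      · exact (mul_pos h5 ((hW a ha b hb h1 h2).2 ⟨rfl, rfl⟩ s hs hsp hsa hsb)).not_gt
  have hL : ∀ a ∈ S, ∀ b ∈ S, slant ε p a < 0 → 0 < slant ε p b →
      (insideCount S {p, a, b} = S.card - 3 ↔
        (a = q ∧ b = r ∧ 0 < orient p q r) ∨ (a = q' ∧ b = r' ∧ orient p q' r' < 0)) := by
    intro a ha b hb h1 h2
    obtain ⟨e1, e2, e3, e4⟩ := horient a ha b hb h1 h2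
    have hc : ({p, a, b} : Finset Plane).card = 3 :=
      Finset.card_eq_three.2 ⟨p, a, b, e1, e2, e3, rfl⟩
    have hsub : ({p, a, b} : Finset Plane) ⊆ S := by simp [Finset.insert_subset_iff, hp, ha, hb]
    have := insideCount_eq_iff hsub
    rw [hc] at this
    rw [this]
    simp only [encloses_iff e4, Finset.mem_insert, Finset.mem_singleton, not_or]
    constructor
    · intro h
      rcases lt_or_gt_of_ne e4 with h5 | h5
      · right
        obtain ⟨rfl, rfl⟩ := (hW a ha b hb h1 h2).1 fun s hs hsp hsa hsb =>
          pos_of_mul_neg_right (h s hs ⟨hsp, hsa, hsb⟩) h5.le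
        exact ⟨rfl, rfl, h5⟩
      · left
        obtain ⟨rfl, rfl⟩ := (hU a ha b hb h1 h2).1 fun s hs hsp hsa hsb =>
          neg_of_mul_neg_right (h s hs ⟨hsp, hsa, hsb⟩) h5.le
        exact ⟨rfl, rfl, h5⟩
    · rintro (⟨rfl, rfl, h5⟩ | ⟨rfl, rfl, h5⟩) s hs ⟨hsp, hsa, hsb⟩
      · exact mul_neg_of_pos_of_neg h5 ((hU a ha b hb h1 h2).2 ⟨rfl, rfl⟩ s hs hsp hsa hsb)
      · exact mul_neg_of_neg_of_pos h5 ((hW a ha b hb h1 h2).2 ⟨rfl, rfl⟩ s hs hsp hsa hsb)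
  have hE' : ∀ t, t ∈ pairsAt S ε (fun T => insideCount S T = 0) p ↔
      (t = (q, r) ∧ orient p q r < 0) ∨ (t = (q', r') ∧ 0 < orient p q' r') := by
    rintro ⟨a, b⟩
    simp only [pairsAt, Finset.mem_filter, Finset.mem_product, Prod.mk.injEq, and_assoc]
    constructor
    · rintro ⟨ha, hb, h1, h2, h3⟩
      exact (hE a ha b hb h1 h2).1 h3
    · rintro (⟨rfl, rfl, h⟩ | ⟨rfl, rfl, h⟩)
      · exact ⟨hq, hr, hq0, hr0, (hE a hq b hr hq0 hr0).2 (Or.inl ⟨rfl, rfl, h⟩)⟩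
      · exact ⟨hq', hr', hq0', hr0', (hE a hq' b hr' hq0' hr0').2 (Or.inr ⟨rfl, rfl, h⟩)⟩
  have hL' : ∀ t, t ∈ pairsAt S ε (fun T => insideCount S T = S.card - 3) p ↔
      (t = (q, r) ∧ 0 < orient p q r) ∨ (t = (q', r') ∧ orient p q' r' < 0) := by
    rintro ⟨a, b⟩
    simp only [pairsAt, Finset.mem_filter, Finset.mem_product, Prod.mk.injEq, and_assoc]
    constructor
    · rintro ⟨ha, hb, h1, h2, h3⟩
      exact (hL a ha b hb h1 h2).1 h3
    · rintro (⟨rfl, rfl, h⟩ | ⟨rfl, rfl, h⟩)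
      · exact ⟨hq, hr, hq0, hr0, (hL a hq b hr hq0 hr0).2 (Or.inl ⟨rfl, rfl, h⟩)⟩
      · exact ⟨hq', hr', hq0', hr0', (hL a hq' b hr' hq0' hr0').2 (Or.inr ⟨rfl, rfl, h⟩)⟩
  have ou := (horient q hq r hr hq0 hr0).2.2.2
  have ow := (horient q' hq' r' hr' hq0' hr0').2.2.2
  generalize pairsAt S ε (fun T => insideCount S T = 0) p = E at *
  generalize pairsAt S ε (fun T => insideCount S T = S.card - 3) p = L at *
  rcases lt_or_gt_of_ne ou with hu | hu <;> rcases lt_or_gt_of_ne ow with hw | hw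
  · have h1 : E = {(q, r)} := by ext t; simp [hE', hu, hw.not_gt]
    have h2 : L = {(q', r')} := by ext t; simp [hL', hw, hu.not_gt]
    have h3 : p ∉ convexHull ℝ ((S : Set Plane) \ {p}) := by rw [hconv]; simp [hw.le]
    simp [h1, h2, h3]
  · have h1 : E = {(q, r), (q', r')} := by ext t; simp [hE', hu, hw]
    have h2 : L = ∅ := by ext t; simp [hL', hu.le, hw.le]
    have h3 : p ∈ convexHull ℝ ((S : Set Plane) \ {p}) := by rw [hconv]; exact ⟨hu, hw⟩
    simp [h1, h2, h3, Finset.card_pair hne]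
  · exact absurd (hcomp hu) hw.not_gt
  · have h1 : E = {(q', r')} := by ext t; simp [hE', hu.not_gt, hw]
    have h2 : L = {(q, r)} := by ext t; simp [hL', hu, hw.not_gt]
    have h3 : p ∉ convexHull ℝ ((S : Set Plane) \ {p}) := by rw [hconv]; simp [hu.le]
    simp [h1, h2, h3]

open scoped Classical in
/-- The points of `S` in the convex hull of the others. -/
def hiddenPoints (S : Finset Plane) : Finset Plane :=
  S.filter fun p => p ∈ convexHull ℝ ((S : Set Plane) \ {p})

open scoped Classical in
lemma exists_extreme_points (hn : 2 ≤ S.card)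
    (hε : ∀ p ∈ S, ∀ q ∈ S, q ≠ p → slant ε p q ≠ 0) :
    ∃ a ∈ S, ∃ b ∈ S, a ≠ b ∧ (∀ s ∈ S, 0 ≤ slant ε a s) ∧ ∀ s ∈ S, slant ε b s ≤ 0 := by
  have hne : S.Nonempty := Finset.card_pos.1 (by omega)
  obtain ⟨a, ha, hmin⟩ := Finset.exists_min_image S (fun s => s 0 + ε * s 1) hne
  obtain ⟨b, hb, hmax⟩ := Finset.exists_max_image S (fun s => s 0 + ε * s 1) hne
  have h1 : ∀ s ∈ S, 0 ≤ slant ε a s := fun s hs => by rw [slant_eq_sub]; linarith [hmin s hs]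
  have h2 : ∀ s ∈ S, slant ε b s ≤ 0 := fun s hs => by rw [slant_eq_sub]; linarith [hmax s hs]
  refine ⟨a, ha, b, hb, ?_, h1, h2⟩
  rintro rfl
  obtain ⟨s, hs, hsa⟩ := Finset.exists_mem_ne (by omega : 1 < S.card) a
  exact hε a ha s hs hsa (le_antisymm (h2 s hs) (h1 s hs))

/-- The numbers of empty circles and of circles enclosing all other points. -/
lemma circleCount_zero_and_top (hn : 4 ≤ S.card) (hS : GeneralPosition S) :
    circleCount S 0 = (S.card - 2) + (hiddenPoints S).card ∧
      circleCount S (S.card - 3) + (hiddenPoints S).card = S.card - 2 := by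
  classical
  obtain ⟨ε, hε⟩ := exists_generic_slant S
  obtain ⟨a, ha, b, hb, hab, hmin, hmax⟩ := exists_extreme_points (by omega) hε
  have hself : ∀ p, slant ε p p = 0 := by simp [slant]
  -- The two extreme points in the chosen direction are never the middle of a triple; this is the
  -- `2` in `S.card - 2`.
  have hempty : ∀ p, p = a ∨ p = b → ∀ P, pairsAt S ε P p = ∅ := by
    intro p hp P
    rw [pairsAt, Finset.filter_eq_empty_iff]
    rintro ⟨q, r⟩ ht ⟨h1, h2, -⟩
    rw [Finset.mem_product] at ht
    rcases hp with rfl | rfl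
    · exact absurd h1 (hmin q ht.1).not_gt
    · exact absurd h2 (hmax r ht.2).not_gt
  have hnota : a ∉ convexHull ℝ ((S : Set Plane) \ {a}) := by
    refine notMem_convexHull_of_linear (-1) (-ε) ?_
    rintro s ⟨hs, hsa⟩
    have := lt_of_le_of_ne (hmin s hs) (hε a ha s hs hsa).symm
    unfold slant at this
    linarith
  have hnotb : b ∉ convexHull ℝ ((S : Set Plane) \ {b}) := by
    refine notMem_convexHull_of_linear 1 ε ?_
    rintro s ⟨hs, hsb⟩
    have := lt_of_le_of_ne (hmax s hs) (hε b hb s hs hsb)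
    unfold slant at this
    linarith
  have hba : b ∈ S.erase a := Finset.mem_erase.2 ⟨hab.symm, hb⟩
  have hsplit : ∀ f : Plane → ℕ, ∑ p ∈ S, f p = f a + (f b + ∑ p ∈ (S.erase a).erase b, f p) := by
    intro f
    rw [Finset.add_sum_erase _ f hba, Finset.add_sum_erase _ f ha]
  have hcard : ((S.erase a).erase b).card = S.card - 2 := by
    rw [Finset.card_erase_of_mem hba, Finset.card_erase_of_mem ha]; omega
  have hmid : ∀ p ∈ (S.erase a).erase b,
      (pairsAt S ε (fun T => insideCount S T = 0) p).card =
        1 + (if p ∈ convexHull ℝ ((S : Set Plane) \ {p}) then 1 else 0) ∧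
      (pairsAt S ε (fun T => insideCount S T = S.card - 3) p).card +
        (if p ∈ convexHull ℝ ((S : Set Plane) \ {p}) then 1 else 0) = 1 := by
    intro p hp
    simp only [Finset.mem_erase] at hp
    obtain ⟨hpb, hpa, hp⟩ := hp
    have h1 := lt_of_le_of_ne (hmin p hp) (hε a ha p hp hpa).symm
    have h2 := lt_of_le_of_ne (hmax p hp) (hε b hb p hp hpb)
    rw [slant_eq_sub] at h1 h2
    exact card_pairsAt hn hS hp (hε p hp) ⟨a, ha, by rw [slant_eq_sub]; linarith⟩
      ⟨b, hb, by rw [slant_eq_sub]; linarith⟩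
  have hH : (hiddenPoints S).card = ∑ p ∈ (S.erase a).erase b,
      (if p ∈ convexHull ℝ ((S : Set Plane) \ {p}) then 1 else 0) := by
    rw [hiddenPoints, Finset.card_filter, hsplit, if_neg hnota, if_neg hnotb, zero_add, zero_add]
  have hc : ∀ j, circleCount S j = ∑ p ∈ (S.erase a).erase b,
      (pairsAt S ε (fun T => insideCount S T = j) p).card := by
    intro j
    have := card_filter_powersetCard_three hε (fun T => insideCount S T = j)
    rw [hsplit, hempty a (Or.inl rfl), hempty b (Or.inr rfl), Finset.card_empty, zero_add,
      zero_add] at this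
    rw [← this, circleCount]
    congr!
  rw [hc, hc, hH, ← Finset.sum_add_distrib, ← hcard, Finset.card_eq_sum_ones,
    ← Finset.sum_add_distrib]
  exact ⟨Finset.sum_congr rfl fun p hp => (hmid p hp).1,
    Finset.sum_congr rfl fun p hp => (hmid p hp).2⟩

end Counts

/-! ### Hidden points and convex position -/

open scoped Classical in
lemma convexPosition_iff (S : Finset Plane) : ConvexPosition S ↔ hiddenPoints S = ∅ := by
  unfold ConvexPosition hiddenPoints
  rw [convexIndependent_set_iff_notMem_convexHull_sdiff, Finset.filter_eq_empty_iff]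
  rfl

open scoped Classical in
lemma hiddenPoints_eq_empty_of_subset {S S' : Finset Plane} (h : S' ⊆ S)
    (hS : hiddenPoints S = ∅) : hiddenPoints S' = ∅ := by
  unfold hiddenPoints at *
  rw [Finset.filter_eq_empty_iff] at *
  intro p hp hp'
  exact hS (h hp) (convexHull_mono (Set.sdiff_subset_sdiff_left (Finset.coe_subset.2 h)) hp')

lemma mem_hiddenPoints {S : Finset Plane} {p : Plane} :
    p ∈ hiddenPoints S ↔ p ∈ S ∧ p ∈ convexHull ℝ ((S : Set Plane) \ {p}) := by
  simp [hiddenPoints]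

/-- If it were zero, only two points would be unhidden. By Krein–Milman the hull would be contained
in a segment, against general position. Positivity makes this count the leading coefficient. -/
lemma circleCount_top_pos {S : Finset Plane} (hn : 4 ≤ S.card) (hS : GeneralPosition S) :
    0 < circleCount S (S.card - 3) := by
  classical
  by_contra hcon
  have htop := (circleCount_zero_and_top hn hS).2
  have hsub : hiddenPoints S ⊆ S := Finset.filter_subset _ _
  have hcard : (S \ hiddenPoints S).card = 2 := by
    rw [Finset.card_sdiff_of_subset hsub]; omega
  obtain ⟨a, b, hab, hEq⟩ := Finset.card_eq_two.1 hcard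
  have hext : (convexHull ℝ (S : Set Plane)).extremePoints ℝ ⊆ {a, b} := by
    intro x hx
    have hxS : x ∈ S := extremePoints_convexHull_subset hx
    have hx' := ((convex_convexHull ℝ (S : Set Plane)).mem_extremePoints_iff_mem_sdiff_convexHull_sdiff.1
      hx).2
    have : x ∈ S \ hiddenPoints S := by
      rw [Finset.mem_sdiff, mem_hiddenPoints]
      refine ⟨hxS, fun h => hx' ?_⟩
      exact convexHull_mono (Set.sdiff_subset_sdiff_left (subset_convexHull ℝ _)) h.2
    rw [hEq] at this
    simpa using this
  have hhull : convexHull ℝ (S : Set Plane) ⊆ segment ℝ a b := by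
    rw [← closure_convexHull_extremePoints (S.finite_toSet.isCompact_convexHull ℝ)
      (convex_convexHull ℝ _)]
    refine closure_minimal ?_ ?_
    · rw [← convexHull_pair]
      exact convexHull_mono hext
    · rw [← convexHull_pair]
      exact (Set.toFinite {a, b}).isClosed_convexHull ℝ
  have hc : ({a, b} : Finset Plane).card < S.card := lt_of_le_of_lt Finset.card_le_two (by omega)
  obtain ⟨c, hcS, hc'⟩ := Finset.exists_mem_notMem_of_card_lt_card hc
  simp only [Finset.mem_insert, Finset.mem_singleton, not_or] at hc'
  have haS : a ∈ S := (Finset.mem_sdiff.1 (by rw [hEq]; simp : a ∈ S \ hiddenPoints S)).1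
  have hbS : b ∈ S := (Finset.mem_sdiff.1 (by rw [hEq]; simp : b ∈ S \ hiddenPoints S)).1
  obtain ⟨u, v, -, -, huv, rfl⟩ := hhull (subset_convexHull ℝ _ hcS)
  refine hS.orient_ne_zero haS hbS hcS hab (Ne.symm hc'.1) (Ne.symm hc'.2) ?_
  unfold orient
  simp only [PiLp.add_apply, PiLp.smul_apply, smul_eq_mul]
  linear_combination (a 1 * b 0 - a 0 * b 1) * huv

/-! ### Double counting over deleted points -/

lemma insideCount_erase_of_encloses {S T : Finset Plane} {p : Plane} [DecidableEq Plane]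
    (hp : p ∈ S) (h : Encloses T p) : insideCount (S.erase p) T + 1 = insideCount S T := by
  classical
  unfold insideCount
  rw [Finset.filter_erase]
  exact Finset.card_erase_add_one (Finset.mem_filter.2 ⟨hp, h⟩)

lemma insideCount_erase_of_not_encloses {S T : Finset Plane} {p : Plane} [DecidableEq Plane]
    (h : ¬ Encloses T p) : insideCount (S.erase p) T = insideCount S T := by
  classical
  unfold insideCount
  rw [Finset.filter_erase, Finset.erase_eq_of_notMem]
  simp [h]

open scoped Classical in
/-- Double counting of the circles in the sets obtained by removing a point. -/
lemma sum_circleCount_erase (S : Finset Plane) (j : ℕ) :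
    ∑ p ∈ S, circleCount (S.erase p) j =
      (S.card - 3 - j) * circleCount S j + (j + 1) * circleCount S (j + 1) := by
  have h1 : ∀ p ∈ S, circleCount (S.erase p) j = ∑ T ∈ S.powersetCard 3,
      if p ∉ T ∧ insideCount (S.erase p) T = j then 1 else 0 := by
    intro p _
    rw [← Finset.card_filter, circleCount]
    congr 1
    ext T
    simp only [Finset.mem_filter, Finset.mem_powersetCard, Finset.subset_erase]
    tauto
  rw [Finset.sum_congr rfl h1, Finset.sum_comm]
  have h2 : ∀ T ∈ S.powersetCard 3,
      (∑ p ∈ S, if p ∉ T ∧ insideCount (S.erase p) T = j then 1 else 0) =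
        (if insideCount S T = j then S.card - 3 - j else 0) +
          (if insideCount S T = j + 1 then j + 1 else 0) := by
    intro T hT
    obtain ⟨hTS, hT3⟩ := Finset.mem_powersetCard.1 hT
    rw [← Finset.card_filter]
    by_cases hj : insideCount S T = j
    · rw [if_pos hj, if_neg (by omega), add_zero]
      -- With `j` points already inside, the deleted point must be neither on nor inside the circle.
      have : (S.filter fun p => p ∉ T ∧ insideCount (S.erase p) T = j) =
          (S \ T) \ S.filter fun s => Encloses T s := by
        ext p
        simp only [Finset.mem_filter, Finset.mem_sdiff]
        constructor
        · rintro ⟨hp, hpT, hc⟩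
          refine ⟨⟨hp, hpT⟩, fun h => ?_⟩
          have := insideCount_erase_of_encloses hp h.2
          omega
        · rintro ⟨⟨hp, hpT⟩, h⟩
          exact ⟨hp, hpT, by rw [insideCount_erase_of_not_encloses (fun h' => h ⟨hp, h'⟩), hj]⟩
      rw [this, Finset.card_sdiff_of_subset, Finset.card_sdiff_of_subset hTS, hT3]
      · change _ - insideCount S T = _
        rw [hj]
      · intro s hs
        rw [Finset.mem_filter] at hs
        exact Finset.mem_sdiff.2 ⟨hs.1, fun h => not_encloses_of_mem h hs.2⟩
    · rw [if_neg hj, zero_add]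
      -- With any other inside count, the deletion must remove an inside point, which requires
      -- exactly `j + 1` of them.
      have : (S.filter fun p => p ∉ T ∧ insideCount (S.erase p) T = j) =
          if insideCount S T = j + 1 then S.filter fun s => Encloses T s else ∅ := by
        ext p
        have key : (p ∈ S ∧ p ∉ T ∧ insideCount (S.erase p) T = j) ↔
            insideCount S T = j + 1 ∧ p ∈ S ∧ Encloses T p := by
          constructor
          · rintro ⟨hp, hpT, hc⟩
            by_cases h : Encloses T p
            · have := insideCount_erase_of_encloses hp h
              exact ⟨by omega, hp, h⟩
            · rw [insideCount_erase_of_not_encloses h] at hc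
              exact absurd hc hj
          · rintro ⟨hc, hp, h⟩
            have := insideCount_erase_of_encloses hp h
            exact ⟨hp, fun hpT => not_encloses_of_mem hpT h, by omega⟩
        split_ifs with h <;> simp [key, h]
      rw [this]
      split_ifs with h
      · exact h
      · rfl
  rw [Finset.sum_congr rfl h2, Finset.sum_add_distrib, ← Finset.sum_filter, ← Finset.sum_filter,
    Finset.sum_const, Finset.sum_const, smul_eq_mul, smul_eq_mul, mul_comm, mul_comm (j + 1)]
  rw [circleCount, circleCount]

/-- With all smaller sets known, `sum_circleCount_erase` determines the count at `j + 1` from that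
at `j`. The inner induction starts from the number of empty circles; the outer one starts at three
points, where the circle count for `4 ≤ S.card` does not apply. -/
lemma circleCount_of_hiddenPoints_eq_empty (m : ℕ) (S : Finset Plane) (hm : S.card = m + 3)
    (hS : GeneralPosition S) (hH : hiddenPoints S = ∅) (j : ℕ) (hj : j ≤ m) :
    circleCount S j = (j + 1) * (m + 1 - j) := by
  classical
  induction m generalizing S j with
  | zero =>
    obtain rfl : j = 0 := by omega
    have h0 : insideCount S S = 0 := insideCount_eq_zero_iff.2 fun s hs hs' => absurd hs hs'
    have h3 : S.powersetCard 3 = {S} := by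
      rw [← Finset.powersetCard_self S, hm]
    simp [circleCount, h3, h0, Finset.filter_singleton]
  | succ m ih =>
    induction j with
    | zero =>
      rw [(circleCount_zero_and_top (by omega) hS).1, hH, hm]
      simp
    | succ j ihj =>
      have hrec := sum_circleCount_erase S j
      have h1 : ∀ p ∈ S, circleCount (S.erase p) j = (j + 1) * (m + 1 - j) := fun p hp =>
        ih _ (by rw [Finset.card_erase_of_mem hp]; omega) (hS.mono (Finset.erase_subset _ _))
          (hiddenPoints_eq_empty_of_subset (Finset.erase_subset _ _) hH) j (by omega)
      rw [Finset.sum_congr rfl h1, Finset.sum_const, smul_eq_mul, ihj (by omega), hm] at hrec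
      obtain ⟨d, rfl⟩ := Nat.exists_eq_add_of_le (show j ≤ m by omega)
      have e1 : j + d + 1 - j = d + 1 := by omega
      have e2 : j + d + 1 + 3 - 3 - j = d + 1 := by omega
      have e3 : j + d + 1 + 1 - j = d + 2 := by omega
      have e4 : j + d + 1 + 1 - (j + 1) = d + 1 := by omega
      rw [e1, e2, e3] at hrec
      rw [e4]
      have hj1 : 0 < j + 1 := Nat.succ_pos j
      apply Nat.eq_of_mul_eq_mul_left hj1
      nlinarith [hrec]

/-! ### Roots of the polynomial of convex position -/

lemma norm_coeff_zero_eq_of_roots {q : Polynomial ℂ} (hq : q ≠ 0)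
    (h : ∀ z : ℂ, q.IsRoot z → ‖z‖ = 1) : ‖q.coeff 0‖ = ‖q.leadingCoeff‖ := by
  rw [(IsAlgClosed.splits q).coeff_zero_eq_leadingCoeff_mul_prod_roots]
  have : ‖q.roots.prod‖ = 1 := by
    rw [← coe_nnnorm, ← nnnormHom_apply, map_multiset_prod, Multiset.prod_eq_one, NNReal.coe_one]
    intro x hx
    obtain ⟨z, hz, rfl⟩ := Multiset.mem_map.1 hx
    exact NNReal.eq (h z ((Polynomial.mem_roots hq).1 hz))
  simp [this]

/-- The polynomial `∑ (j + 1) (m - j) z ^ j`, `j < m`. -/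
def convexCirclePoly (m : ℕ) : Polynomial ℂ :=
  ∑ j ∈ Finset.range m, Polynomial.C (((j : ℂ) + 1) * (m - j)) * Polynomial.X ^ j

/-- `e^{-i(m-1)t/2}` times the value of `convexCirclePoly m` at `e^{it}`. -/
def convexCircleTrig (m : ℕ) (t : ℝ) : ℝ :=
  ∑ j ∈ Finset.range m, ((j : ℝ) + 1) * (m - j) * Real.cos ((j - ((m : ℝ) - 1) / 2) * t)

lemma eval_convexCirclePoly (m : ℕ) (t : ℝ) :
    (convexCirclePoly m).eval (Complex.exp (t * Complex.I)) =
      Complex.exp ((((m : ℂ) - 1) / 2 * t) * Complex.I) * convexCircleTrig m t := by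
  set F : ℕ → ℂ := fun j => ((j : ℂ) + 1) * (m - j) *
    Complex.exp (((j - ((m : ℂ) - 1) / 2) * t) * Complex.I) with hF
  set G : ℕ → ℂ := fun j => ((j : ℂ) + 1) * (m - j) *
    Complex.exp (-((j - ((m : ℂ) - 1) / 2) * t) * Complex.I) with hG
  -- The coefficients are symmetric under `j ↦ m - 1 - j`, so conjugate exponentials pair into
  -- cosines.
  have hFG : ∑ j ∈ Finset.range m, G j = ∑ j ∈ Finset.range m, F j := by
    rw [← Finset.sum_range_reflect F]
    refine Finset.sum_congr rfl fun j hj => ?_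
    have hj := Finset.mem_range.1 hj
    have e : ((m - 1 - j : ℕ) : ℂ) = m - 1 - j := by
      rw [Nat.sub_sub, Nat.cast_sub (by omega)]; push_cast; ring
    simp only [hF, hG, e]
    rw [show (m : ℂ) - (m - 1 - j) = j + 1 by ring, show (m : ℂ) - 1 - j + 1 = m - j by ring,
      mul_comm ((m : ℂ) - j)]
    congr 3
    ring
  have hT : (convexCircleTrig m t : ℂ) = ∑ j ∈ Finset.range m, F j := by
    have h2 : (2 : ℂ) * convexCircleTrig m t = ∑ j ∈ Finset.range m, (F j + G j) := by
      rw [convexCircleTrig]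
      push_cast
      rw [Finset.mul_sum]
      refine Finset.sum_congr rfl fun j _ => ?_
      rw [Complex.cos]
      simp only [hF, hG]
      ring
    rw [Finset.sum_add_distrib, hFG, ← two_mul] at h2
    exact mul_left_cancel₀ two_ne_zero h2
  rw [hT, convexCirclePoly, Polynomial.eval_finsetSum, Finset.mul_sum]
  refine Finset.sum_congr rfl fun j _ => ?_
  simp only [hF, Polynomial.eval_mul, Polynomial.eval_C, Polynomial.eval_pow, Polynomial.eval_X]
  rw [← Complex.exp_nat_mul, mul_left_comm (Complex.exp _), ← Complex.exp_add]
  congr 2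
  ring

/-- A function with equal values at the zeros of `sin ((m + 1) t / 2)`, `0 < t < 2π`, whose
derivative is `sin ((m + 1) t / 2)` times `convexCircleTrig m t`. -/
def convexCirclePrimitive (m : ℕ) (t : ℝ) : ℝ :=
  ∑ j ∈ Finset.range m, (-(((j : ℝ) - ((m : ℝ) - 1) / 2) *
    (Real.sin ((j - ((m : ℝ) - 1) / 2) * t) * Real.sin (((m : ℝ) + 1) / 2 * t))) -
      ((m : ℝ) + 1) / 2 * (Real.cos ((j - ((m : ℝ) - 1) / 2) * t) *
        Real.cos (((m : ℝ) + 1) / 2 * t)))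

/-- With `M = (m + 1) / 2` and `a = j - (m - 1) / 2`, the coefficient `(j + 1) (m - j)` equals `M ^
2 - a ^ 2`, and the mixed terms of the derivative cancel. -/
lemma hasDerivAt_convexCirclePrimitive (m : ℕ) (t : ℝ) :
    HasDerivAt (convexCirclePrimitive m)
      (Real.sin (((m : ℝ) + 1) / 2 * t) * convexCircleTrig m t) t := by
  have hlin : ∀ a : ℝ, HasDerivAt (fun t : ℝ => a * t) a t := fun a => by
    simpa using (hasDerivAt_id t).const_mul a
  rw [convexCircleTrig, Finset.mul_sum]
  unfold convexCirclePrimitive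
  refine HasDerivAt.fun_sum fun j _ => ?_
  have h := ((((hlin (j - ((m : ℝ) - 1) / 2)).sin.mul
    (hlin (((m : ℝ) + 1) / 2)).sin).const_mul ((j : ℝ) - ((m : ℝ) - 1) / 2)).neg).sub
    (((hlin (j - ((m : ℝ) - 1) / 2)).cos.mul
      (hlin (((m : ℝ) + 1) / 2)).cos).const_mul (((m : ℝ) + 1) / 2))
  exact h.congr_deriv (by ring)

/-- Where the sine vanishes, only `-M cos (M t)` times a Dirichlet-type sum survives, with `M = (m +
1) / 2`. That sum equals `-cos (M t)`, and `cos (M t) ^ 2 = 1`. -/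
lemma convexCirclePrimitive_eq {m : ℕ} {t : ℝ} (h : Real.sin (((m : ℝ) + 1) / 2 * t) = 0)
    (ht : Real.sin (t / 2) ≠ 0) : convexCirclePrimitive m t = ((m : ℝ) + 1) / 2 := by
  have hsum : ∑ j ∈ Finset.range m, Real.cos ((j - ((m : ℝ) - 1) / 2) * t) =
      -Real.cos (((m : ℝ) + 1) / 2 * t) := by
    -- Multiplying the cosine sum by `2 * sin (t / 2)` makes it telescope.
    have key := Finset.sum_range_sub (fun j : ℕ => Real.sin (((j : ℝ) - (m : ℝ) / 2) * t)) m
    have hterm : ∀ j : ℕ, Real.sin ((((j + 1 : ℕ) : ℝ) - (m : ℝ) / 2) * t) -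
        Real.sin (((j : ℝ) - (m : ℝ) / 2) * t) =
        2 * Real.sin (t / 2) * Real.cos ((j - ((m : ℝ) - 1) / 2) * t) := by
      intro j
      rw [Real.sin_sub_sin]
      congr 3
      · push_cast; ring
      · push_cast; ring
    rw [Finset.sum_congr rfl fun j _ => hterm j, ← Finset.mul_sum] at key
    have e1 : ((m : ℝ) - (m : ℝ) / 2) * t = ((m : ℝ) + 1) / 2 * t - t / 2 := by ring
    have e2 : (((0 : ℕ) : ℝ) - (m : ℝ) / 2) * t = -(((m : ℝ) + 1) / 2 * t - t / 2) := by
      push_cast; ring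
    rw [e1, e2, Real.sin_neg, Real.sin_sub, h] at key
    have h2 : 2 * Real.sin (t / 2) ≠ 0 := mul_ne_zero two_ne_zero ht
    apply mul_left_cancel₀ h2
    rw [key]; ring
  unfold convexCirclePrimitive
  simp only [h, mul_zero, neg_zero, zero_sub]
  rw [Finset.sum_neg_distrib, ← Finset.mul_sum, ← Finset.sum_mul, hsum]
  have := Real.sin_sq_add_cos_sq (((m : ℝ) + 1) / 2 * t)
  rw [h] at this
  linear_combination ((m : ℝ) + 1) / 2 * this

/-- Rolle between consecutive zeros of `sin ((m + 1) t / 2)`: the sine factor does not vanish in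
between, so the zero of the derivative belongs to the cosine sum. -/
lemma exists_convexCircleTrig_eq_zero {m k : ℕ} (hk : k + 1 < m) :
    ∃ s : ℝ, (k + 1 : ℝ) * (2 * Real.pi / (m + 1)) < s ∧
      s < (k + 2 : ℝ) * (2 * Real.pi / (m + 1)) ∧ convexCircleTrig m s = 0 := by
  have hpi := Real.pi_pos
  have hm : (0 : ℝ) < (m : ℝ) + 1 := by positivity
  have hval : ∀ i : ℕ, 0 < i → i ≤ m →
      convexCirclePrimitive m ((i : ℝ) * (2 * Real.pi / (m + 1))) = ((m : ℝ) + 1) / 2 := by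
    intro i hi him
    apply convexCirclePrimitive_eq
    · rw [show ((m : ℝ) + 1) / 2 * ((i : ℝ) * (2 * Real.pi / (m + 1))) = i * Real.pi by field_simp]
      exact Real.sin_nat_mul_pi i
    · refine (Real.sin_pos_of_pos_of_lt_pi ?_ ?_).ne'
      · have : (0 : ℝ) < i := by exact_mod_cast hi
        positivity
      · have : (i : ℝ) < m + 1 := by exact_mod_cast Nat.lt_succ_of_le him
        rw [show (i : ℝ) * (2 * Real.pi / (m + 1)) / 2 = i / (m + 1) * Real.pi by field_simp]
        have h1 : (i : ℝ) / (m + 1) < 1 := (div_lt_one hm).2 this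
        nlinarith
  have hstep : (0 : ℝ) < 2 * Real.pi / (m + 1) := by positivity
  have hlt : (k + 1 : ℝ) * (2 * Real.pi / (m + 1)) < (k + 2 : ℝ) * (2 * Real.pi / (m + 1)) := by
    nlinarith
  have h1 := hval (k + 1) (by omega) (by omega)
  have h2 := hval (k + 2) (by omega) (by omega)
  push_cast at h1 h2
  obtain ⟨s, ⟨hs1, hs2⟩, hs⟩ := exists_hasDerivAt_eq_zero hlt
    (fun x _ => (hasDerivAt_convexCirclePrimitive m x).continuousAt.continuousWithinAt)
    (h1.trans h2.symm) (fun x _ => hasDerivAt_convexCirclePrimitive m x)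
  refine ⟨s, hs1, hs2, (mul_eq_zero.1 hs).resolve_left ?_⟩
  intro h0
  obtain ⟨n, hn⟩ := Real.sin_eq_zero_iff.1 h0
  have e : ∀ a : ℝ, ((m : ℝ) + 1) / 2 * (a * (2 * Real.pi / (m + 1))) = a * Real.pi := by
    intro a; field_simp
  have b1 := mul_lt_mul_of_pos_left hs1 (half_pos hm)
  have b2 := mul_lt_mul_of_pos_left hs2 (half_pos hm)
  rw [e, ← hn] at b1 b2
  have c1 := lt_of_mul_lt_mul_right b1 hpi.le
  have c2 := lt_of_mul_lt_mul_right b2 hpi.le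
  have d1 : (k : ℤ) + 1 < n := by exact_mod_cast c1
  have d2 : n < (k : ℤ) + 2 := by exact_mod_cast c2
  omega

/-- The `m - 1` intervals give distinct angles in `(0, 2π)`, hence `m - 1` distinct roots of modulus
1. The degree is at most `m - 1`, so there are no others. -/
lemma norm_eq_one_of_isRoot_convexCirclePoly {m : ℕ} (hm : 0 < m) {z : ℂ}
    (hz : (convexCirclePoly m).IsRoot z) : ‖z‖ = 1 := by
  classical
  have hcoeff : ∀ i, (convexCirclePoly m).coeff i =
      if i < m then ((i : ℂ) + 1) * (m - i) else 0 := by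
    intro i
    simp only [convexCirclePoly, Polynomial.finsetSum_coeff, Polynomial.coeff_C_mul_X_pow]
    simp only [Finset.sum_ite_eq, Finset.mem_range]
  have hne : convexCirclePoly m ≠ 0 := by
    intro h
    have h0 := hcoeff 0
    rw [h, if_pos hm] at h0
    simp only [Polynomial.coeff_zero, Nat.cast_zero, zero_add, one_mul, sub_zero] at h0
    exact hm.ne (by exact_mod_cast h0)
  have hdeg : (convexCirclePoly m).natDegree ≤ m - 1 := by
    rw [Polynomial.natDegree_le_iff_coeff_eq_zero]
    intro i hi
    rw [hcoeff, if_neg (by omega)]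
  have hex : ∀ k : ℕ, ∃ s : ℝ, k + 1 < m → (k + 1 : ℝ) * (2 * Real.pi / (m + 1)) < s ∧
      s < (k + 2 : ℝ) * (2 * Real.pi / (m + 1)) ∧ convexCircleTrig m s = 0 := fun k => by
    by_cases hk : k + 1 < m
    · obtain ⟨s, hs⟩ := exists_convexCircleTrig_eq_zero hk
      exact ⟨s, fun _ => hs⟩
    · exact ⟨0, fun h => absurd h hk⟩
  choose s hs using hex
  have hstep : (0 : ℝ) < 2 * Real.pi / (m + 1) := by have := Real.pi_pos; positivity
  have hrange : ∀ k, k + 1 < m → 0 < s k ∧ s k < 2 * Real.pi := by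
    intro k hk
    obtain ⟨h1, h2, -⟩ := hs k hk
    refine ⟨lt_trans (by positivity) h1, lt_trans h2 ?_⟩
    have : (k : ℝ) + 2 < m + 1 := by exact_mod_cast (by omega : k + 2 < m + 1)
    calc (k + 2 : ℝ) * (2 * Real.pi / (m + 1)) < (m + 1) * (2 * Real.pi / (m + 1)) := by gcongr
      _ = 2 * Real.pi := by field_simp
  have hmono : ∀ k l, k + 1 < m → l + 1 < m → k < l → s k < s l := by
    intro k l hk hl hkl
    obtain ⟨-, h2, -⟩ := hs k hk
    obtain ⟨h1, -, -⟩ := hs l hl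
    have : (k : ℝ) + 2 ≤ l + 1 := by exact_mod_cast (by omega : k + 2 ≤ l + 1)
    calc s k < _ := h2
      _ ≤ (l + 1 : ℝ) * (2 * Real.pi / (m + 1)) := by gcongr
      _ < s l := h1
  set Z := (Finset.range (m - 1)).image fun k => Complex.exp (s k * Complex.I) with hZ
  have hinj : Set.InjOn (fun k => Complex.exp (s k * Complex.I)) (Finset.range (m - 1)) := by
    have aux : ∀ k l, k + 1 < m → l + 1 < m → k < l →
        Complex.exp (s k * Complex.I) ≠ Complex.exp (s l * Complex.I) := by
      intro k l hk hl hkl h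
      obtain ⟨n, hn⟩ := Complex.exp_eq_exp_iff_exists_int.1 h.symm
      have hn' : s l = s k + n * (2 * Real.pi) := by
        have := congrArg Complex.im hn
        simpa using this
      have h1 := hmono k l hk hl hkl
      have h2 := hrange k hk
      have h3 := hrange l hl
      have hpi := Real.pi_pos
      have p1 : (0 : ℝ) < n := by
        by_contra! hcon
        nlinarith
      have p2 : (n : ℝ) < 1 := by
        by_contra! hcon
        nlinarith
      have p1' : 0 < n := by exact_mod_cast p1
      have p2' : n < 1 := by exact_mod_cast p2
      omega
    intro k hk l hl h
    have hk := Finset.mem_range.1 (Finset.mem_coe.1 hk)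
    have hl := Finset.mem_range.1 (Finset.mem_coe.1 hl)
    rcases lt_trichotomy k l with hkl | hkl | hkl
    · exact absurd h (aux k l (by omega) (by omega) hkl)
    · exact hkl
    · exact absurd h.symm (aux l k (by omega) (by omega) hkl)
  have hZcard : Z.card = m - 1 := by
    rw [hZ, Finset.card_image_of_injOn hinj, Finset.card_range]
  have hZsub : Z ⊆ (convexCirclePoly m).roots.toFinset := by
    intro w hw
    obtain ⟨k, hk, rfl⟩ := Finset.mem_image.1 hw
    rw [Multiset.mem_toFinset, Polynomial.mem_roots hne, Polynomial.IsRoot, eval_convexCirclePoly,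
      (hs k (by have := Finset.mem_range.1 hk; omega)).2.2]
    simp
  have hZeq : Z = (convexCirclePoly m).roots.toFinset := by
    refine Finset.eq_of_subset_of_card_le hZsub ?_
    rw [hZcard]
    exact (Multiset.toFinset_card_le _).trans ((Polynomial.card_roots' _).trans hdeg)
  have hzZ : z ∈ Z := by
    rw [hZeq, Multiset.mem_toFinset, Polynomial.mem_roots hne]
    exact hz
  obtain ⟨k, -, rfl⟩ := Finset.mem_image.1 hzZ
  exact Complex.norm_exp_ofReal_mul_I _

/-! ### Voronoi vertices as circle centres -/

/-- The centers of the circles through exactly three points of `S` with `j` points inside. -/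
def circleCenters (S : Finset Plane) (j : ℕ) : Set Plane :=
  {x | ∃ ρ : ℝ, (S.filter fun s => dist x s < ρ).card = j ∧
    (S.filter fun s => dist x s = ρ).card = 3}

lemma card_filter_dist_le (S : Finset Plane) (x : Plane) (ρ : ℝ) :
    (S.filter fun s => dist x s ≤ ρ).card =
      (S.filter fun s => dist x s < ρ).card + (S.filter fun s => dist x s = ρ).card := by
  classical
  rw [← Finset.card_union_of_disjoint]
  · congr 1
    ext s
    simp only [Finset.mem_filter, Finset.mem_union, le_iff_lt_or_eq]
    tauto
  · rw [Finset.disjoint_filter]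
    intro s _ h h'
    exact h.ne h'

/-- Enlarging the radius past `ρ` swallows the three points on the circle, so the inside count would
grow by at least 3. -/
lemma radius_le_of_card {S : Finset Plane} {x : Plane} {ρ ρ' : ℝ}
    (h3 : (S.filter fun s => dist x s = ρ).card = 3)
    (h : (S.filter fun s => dist x s < ρ').card ≤ (S.filter fun s => dist x s < ρ).card + 2) :
    ρ' ≤ ρ := by
  by_contra! hlt
  have hsub : (S.filter fun s => dist x s ≤ ρ) ⊆ S.filter fun s => dist x s < ρ' := fun s hs => by
    rw [Finset.mem_filter] at hs ⊢
    exact ⟨hs.1, hs.2.trans_lt hlt⟩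
  have := Finset.card_le_card hsub
  rw [card_filter_dist_le] at this
  omega

lemma disjoint_circleCenters_succ (S : Finset Plane) (j : ℕ) :
    Disjoint (circleCenters S (j + 1)) (circleCenters S j) := by
  rw [Set.disjoint_left]
  rintro x ⟨ρ, h1, h2⟩ ⟨ρ', h1', h2'⟩
  obtain rfl : ρ = ρ' := le_antisymm (radius_le_of_card h2' (by omega))
    (radius_le_of_card h2 (by omega))
  omega

lemma filter_dist_eq_of_circle {S T : Finset Plane} (hS : GeneralPosition S) (hT : T ⊆ S)
    (h3 : T.card = 3) {x : Plane} {ρ : ℝ} (h : ∀ a ∈ T, dist x a = ρ) :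
    (S.filter fun s => dist x s = ρ) = T := by
  symm
  refine Finset.eq_of_subset_of_card_le (fun a ha => Finset.mem_filter.2 ⟨hT ha, h a ha⟩) ?_
  rw [h3]
  exact hS.card_filter_dist_le_three x ρ

lemma insideCount_of_circle {S T : Finset Plane} (hS : GeneralPosition S) (hT : T ⊆ S)
    (h3 : T.card = 3) {x : Plane} {ρ : ℝ} (h : ∀ a ∈ T, dist x a = ρ) :
    insideCount S T = (S.filter fun s => dist x s < ρ).card := by
  classical
  obtain ⟨p, q, r, hpq, hpr, hqr, rfl⟩ := Finset.card_eq_three.1 h3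
  have hp := h p (by simp)
  have ho := hS.orient_ne_zero (hT (by simp : p ∈ _)) (hT (by simp : q ∈ _))
    (hT (by simp : r ∈ _)) hpq hpr hqr
  unfold insideCount
  congr 1
  ext s
  rw [Finset.mem_filter, Finset.mem_filter, encloses_iff_of_dist_eq ho
    ((h q (by simp)).trans hp.symm) ((h r (by simp)).trans hp.symm), hp]

lemma exists_circle {S T : Finset Plane} (hS : GeneralPosition S) (hT : T ⊆ S)
    (h3 : T.card = 3) : ∃ x : Plane, ∃ ρ : ℝ, ∀ a ∈ T, dist x a = ρ := by
  classical
  obtain ⟨p, q, r, hpq, hpr, hqr, rfl⟩ := Finset.card_eq_three.1 h3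
  obtain ⟨x, hq, hr⟩ := exists_circumcenter (hS.orient_ne_zero (hT (by simp : p ∈ _))
    (hT (by simp : q ∈ _)) (hT (by simp : r ∈ _)) hpq hpr hqr)
  exact ⟨x, dist x p, by simp [hq, hr]⟩

lemma circle_unique {S T : Finset Plane} (hS : GeneralPosition S) (hT : T ⊆ S)
    (h3 : T.card = 3) {x y : Plane} {ρ σ : ℝ} (hx : ∀ a ∈ T, dist x a = ρ)
    (hy : ∀ a ∈ T, dist y a = σ) : x = y := by
  classical
  obtain ⟨p, q, r, hpq, hpr, hqr, rfl⟩ := Finset.card_eq_three.1 h3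
  have ho := hS.orient_ne_zero (hT (by simp : p ∈ _)) (hT (by simp : q ∈ _))
    (hT (by simp : r ∈ _)) hpq hpr hqr
  exact circumcenter_unique ho ((hx q (by simp)).trans (hx p (by simp)).symm)
    ((hx r (by simp)).trans (hx p (by simp)).symm) ((hy q (by simp)).trans (hy p (by simp)).symm)
    ((hy r (by simp)).trans (hy p (by simp)).symm)

/-- Taking circumcentres is a bijection from the triples with inside count `j`: by
`radius_le_of_card`, the centre and `j` determine the radius, and the points on that circle are the
triple. -/
lemma circleCenters_finite_and_ncard {S : Finset Plane} (hS : GeneralPosition S) (j : ℕ) :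
    (circleCenters S j).Finite ∧ (circleCenters S j).ncard = circleCount S j := by
  classical
  have hex : ∀ T : Finset Plane, ∃ x : Plane, T ⊆ S → T.card = 3 → ∃ ρ, ∀ a ∈ T, dist x a = ρ := by
    intro T
    by_cases h : T ⊆ S ∧ T.card = 3
    · obtain ⟨x, hx⟩ := exists_circle hS h.1 h.2
      exact ⟨x, fun _ _ => hx⟩
    · exact ⟨0, fun h1 h2 => absurd ⟨h1, h2⟩ h⟩
  choose f hf using hex
  set D := (S.powersetCard 3).filter fun T => insideCount S T = j with hD
  have hmem : ∀ T, T ∈ D ↔ T ⊆ S ∧ T.card = 3 ∧ insideCount S T = j := fun T => by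
    simp [hD, and_assoc]
  have himg : circleCenters S j = f '' (D : Set (Finset Plane)) := by
    ext x
    constructor
    · rintro ⟨ρ, h1, h2⟩
      have hsub : (S.filter fun s => dist x s = ρ) ⊆ S := Finset.filter_subset _ _
      have hon : ∀ a ∈ S.filter fun s => dist x s = ρ, dist x a = ρ := fun a ha =>
        (Finset.mem_filter.1 ha).2
      obtain ⟨σ, hσ⟩ := hf _ hsub h2
      refine ⟨S.filter fun s => dist x s = ρ, ?_, circle_unique hS hsub h2 hσ hon⟩
      rw [Finset.mem_coe, hmem]
      exact ⟨hsub, h2, by rw [insideCount_of_circle hS hsub h2 hon, h1]⟩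
    · rintro ⟨T, hT, rfl⟩
      rw [Finset.mem_coe, hmem] at hT
      obtain ⟨ρ, hρ⟩ := hf T hT.1 hT.2.1
      exact ⟨ρ, by rw [← insideCount_of_circle hS hT.1 hT.2.1 hρ, hT.2.2],
        by rw [filter_dist_eq_of_circle hS hT.1 hT.2.1 hρ, hT.2.1]⟩
  have hinj : Set.InjOn f (D : Set (Finset Plane)) := by
    intro T hT T' hT' heq
    rw [Finset.mem_coe, hmem] at hT hT'
    obtain ⟨h1, h2, h3⟩ := hT
    obtain ⟨h1', h2', h3'⟩ := hT'
    obtain ⟨ρ, hρ⟩ := hf T h1 h2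
    obtain ⟨ρ', hρ'⟩ := hf T' h1' h2'
    rw [← heq] at hρ'
    have e := filter_dist_eq_of_circle hS h1 h2 hρ
    have e' := filter_dist_eq_of_circle hS h1' h2' hρ'
    rw [insideCount_of_circle hS h1 h2 hρ] at h3
    rw [insideCount_of_circle hS h1' h2' hρ'] at h3'
    obtain rfl : ρ = ρ' := le_antisymm (radius_le_of_card (by rw [e', h2']) (by omega))
      (radius_le_of_card (by rw [e, h2]) (by omega))
    rw [← e, ← e']
  rw [himg]
  refine ⟨D.finite_toSet.image f, ?_⟩
  rw [hinj.ncard_image, Set.ncard_coe_finset, circleCount]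

lemma exists_kth_radius {S : Finset Plane} (x : Plane) {k : ℕ} (hk : 1 ≤ k) (hkS : k ≤ S.card) :
    ∃ ρ : ℝ, (S.filter fun s => dist x s < ρ).card < k ∧
      k ≤ (S.filter fun s => dist x s ≤ ρ).card := by
  classical
  obtain ⟨m, hm, hmax⟩ := Finset.exists_max_image S (dist x) (Finset.card_pos.1 (by omega))
  -- `dist x a` is the `k`-th smallest distance: the least one within which there are at least `k`
  -- points.
  obtain ⟨a, ha, hmin⟩ := Finset.exists_min_image
    (S.filter fun s => k ≤ (S.filter fun t => dist x t ≤ dist x s).card) (dist x)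
    ⟨m, Finset.mem_filter.2 ⟨hm, by rwa [Finset.filter_true_of_mem hmax]⟩⟩
  rw [Finset.mem_filter] at ha
  refine ⟨dist x a, ?_, ha.2⟩
  by_contra! hcon
  obtain ⟨b, hb, hbmax⟩ := Finset.exists_max_image (S.filter fun s => dist x s < dist x a) (dist x)
    (Finset.card_pos.1 (by omega))
  rw [Finset.mem_filter] at hb
  refine (hmin b (Finset.mem_filter.2 ⟨hb.1, hcon.trans (Finset.card_le_card fun s hs => ?_)⟩)).not_gt
    hb.2
  exact Finset.mem_filter.2 ⟨(Finset.mem_filter.1 hs).1, hbmax s hs⟩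

/-- The number of order-`k` Voronoi cells at a point. -/
lemma ncard_cells {S : Finset Plane} {x : Plane} {k : ℕ} {ρ : ℝ}
    (h1 : (S.filter fun s => dist x s < ρ).card < k)
    (h2 : k ≤ (S.filter fun s => dist x s ≤ ρ).card) :
    {T : Finset Plane | T ⊆ S ∧ T.card = k ∧ x ∈ voronoiCell S T}.ncard =
      (S.filter fun s => dist x s = ρ).card.choose
        (k - (S.filter fun s => dist x s < ρ).card) := by
  classical
  set I := S.filter fun s => dist x s < ρ with hI
  set B := S.filter fun s => dist x s = ρ with hB
  set C := S.filter fun s => dist x s ≤ ρ with hC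
  have hdisj : Disjoint I B := by
    rw [hI, hB, Finset.disjoint_filter]
    intro s _ h h'
    exact h.ne h'
  have hmI : ∀ s, s ∈ I ↔ s ∈ S ∧ dist x s < ρ := fun s => by rw [hI, Finset.mem_filter]
  have hmB : ∀ s, s ∈ B ↔ s ∈ S ∧ dist x s = ρ := fun s => by rw [hB, Finset.mem_filter]
  have hmC : ∀ s, s ∈ C ↔ s ∈ S ∧ dist x s ≤ ρ := fun s => by rw [hC, Finset.mem_filter]
  rw [← Finset.card_powersetCard]
  -- A cell contains `x` exactly when its set takes all points strictly inside radius `ρ`, none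
  -- outside, and fills up with points on the circle.
  have himg : {T : Finset Plane | T ⊆ S ∧ T.card = k ∧ x ∈ voronoiCell S T} =
      (fun U => I ∪ U) '' (B.powersetCard (k - I.card) : Set (Finset Plane)) := by
    ext T
    simp only [Set.mem_ofPred_eq, Set.mem_image, Finset.mem_coe, Finset.mem_powersetCard]
    constructor
    · rintro ⟨hTS, hTk, hcell⟩
      have hIT : I ⊆ T := by
        intro s hs
        by_contra hsT
        have hsub : T ⊆ I := fun a ha => (hmI a).2 ⟨hTS ha,
          (hcell a ha s ((hmI s).1 hs).1 hsT).trans_lt ((hmI s).1 hs).2⟩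
        have := Finset.card_le_card hsub
        omega
      have hTC : T ⊆ C := by
        intro a ha
        by_contra haC
        have hda : ρ < dist x a := by
          by_contra! h
          exact haC ((hmC a).2 ⟨hTS ha, h⟩)
        have hsub : C ⊆ T.erase a := by
          intro b hb
          rw [Finset.mem_erase]
          refine ⟨fun h => haC (h ▸ hb), ?_⟩
          by_contra hbT
          have := hcell a ha b ((hmC b).1 hb).1 hbT
          linarith [((hmC b).1 hb).2]
        have := Finset.card_le_card hsub
        rw [Finset.card_erase_of_mem ha] at this
        omega
      refine ⟨T \ I, ⟨fun a ha => ?_, ?_⟩, Finset.union_sdiff_of_subset hIT⟩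
      · rw [Finset.mem_sdiff] at ha
        have h := (hmC a).1 (hTC ha.1)
        refine (hmB a).2 ⟨h.1, le_antisymm h.2 ?_⟩
        by_contra! hlt
        exact ha.2 ((hmI a).2 ⟨h.1, hlt⟩)
      · rw [Finset.card_sdiff_of_subset hIT, hTk]
    · rintro ⟨U, ⟨hUB, hUc⟩, rfl⟩
      refine ⟨?_, ?_, ?_⟩
      · exact Finset.union_subset (Finset.filter_subset _ _)
          (hUB.trans (Finset.filter_subset _ _))
      · rw [Finset.card_union_of_disjoint (Finset.disjoint_of_subset_right hUB hdisj), hUc]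
        omega
      · intro a ha b hb hbn
        rw [Finset.mem_union, not_or] at hbn
        have hb' : ρ ≤ dist x b := by
          by_contra! h
          exact hbn.1 ((hmI b).2 ⟨hb, h⟩)
        rcases Finset.mem_union.1 ha with ha | ha
        · exact ((hmI a).1 ha).2.le.trans hb'
        · exact ((hmB a).1 (hUB ha)).2.le.trans hb'
  rw [himg, Set.InjOn.ncard_image, Set.ncard_coe_finset]
  intro U hU U' hU' h
  rw [Finset.mem_coe, Finset.mem_powersetCard] at hU hU'
  have e : ∀ V, V ⊆ B → (I ∪ V) \ I = V := fun V hV => by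
    rw [Finset.union_sdiff_left]
    exact Finset.sdiff_eq_self_of_disjoint (Finset.disjoint_of_subset_right hV hdisj).symm
  rw [← e U hU.1, ← e U' hU'.1]
  exact congrArg (· \ I) h

lemma eq_three_of_three_le_choose {b d : ℕ} (hb : b ≤ 3) (hd : 1 ≤ d) (hdb : d ≤ b)
    (h : 3 ≤ b.choose d) : b = 3 ∧ d ≠ 3 := by
  interval_cases b <;> interval_cases d <;> simp_all [Nat.choose]

/-- At the `(k + 1)`-th radius, with `i` points inside and `b ≤ 3` on the circle, the number of
cells is `b.choose (k + 1 - i)`. It reaches 3 only for `b = 3` and `k + 1 - i = 1` or `2`. The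
existential over `i` leaves the second set empty at `k = 0`. -/
lemma voronoiVertices_succ {S : Finset Plane} (hS : GeneralPosition S) {k : ℕ}
    (hk : k + 1 ≤ S.card) :
    voronoiVertices S (k + 1) =
      circleCenters S k ∪ {x | ∃ i, k = i + 1 ∧ x ∈ circleCenters S i} := by
  ext x
  rw [voronoiVertices, Set.mem_ofPred_eq, Set.mem_union, Set.mem_ofPred_eq]
  constructor
  · intro h
    obtain ⟨ρ, h1, h2⟩ := exists_kth_radius x (Nat.succ_pos k) hk
    rw [ncard_cells h1 h2] at h
    rw [card_filter_dist_le] at h2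
    have h3 := hS.card_filter_dist_le_three x ρ
    set i := (S.filter fun s => dist x s < ρ).card with hi
    set b := (S.filter fun s => dist x s = ρ).card with hb
    have hd : 1 ≤ k + 1 - i := by omega
    have hd' : k + 1 - i ≤ 3 := by omega
    generalize hdd : k + 1 - i = d at *
    have hb3 := eq_three_of_three_le_choose h3 hd (by omega) h
    have : d = 1 ∨ d = 2 := by omega
    rcases this with rfl | rfl
    · left
      exact ⟨ρ, by omega, hb3.1⟩
    · right
      exact ⟨i, by omega, ρ, rfl, hb3.1⟩
  · rintro (⟨ρ, h1, h2⟩ | ⟨i, rfl, ρ, h1, h2⟩)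
    · rw [ncard_cells (ρ := ρ) (by omega) (by rw [card_filter_dist_le]; omega), h1, h2,
        show k + 1 - k = 1 by omega]
      decide
    · rw [ncard_cells (ρ := ρ) (by omega) (by rw [card_filter_dist_le]; omega), h1, h2,
        show i + 1 + 1 - i = 2 by omega]
      decide

lemma numVoronoiVertices_one {S : Finset Plane} (hS : GeneralPosition S) (h : 1 ≤ S.card) :
    numVoronoiVertices S 1 = circleCount S 0 := by
  rw [numVoronoiVertices, voronoiVertices_succ hS (k := 0) h,
    ← (circleCenters_finite_and_ncard hS 0).2]
  congr 1
  simp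

lemma numVoronoiVertices_succ_succ {S : Finset Plane} (hS : GeneralPosition S) {k : ℕ}
    (hk : k + 2 ≤ S.card) :
    numVoronoiVertices S (k + 2) = circleCount S (k + 1) + circleCount S k := by
  have e : {x | ∃ i, k + 1 = i + 1 ∧ x ∈ circleCenters S i} = circleCenters S k := by
    ext x
    simp
  rw [numVoronoiVertices, voronoiVertices_succ hS (k := k + 1) hk, e,
    Set.ncard_union_eq (disjoint_circleCenters_succ S k) (circleCenters_finite_and_ncard hS _).1
      (circleCenters_finite_and_ncard hS _).1, (circleCenters_finite_and_ncard hS _).2,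
    (circleCenters_finite_and_ncard hS _).2]

/-! ### Factorization and the two implications -/

/-- The generating polynomial of the numbers of circles. -/
def circlePolynomial (S : Finset Plane) : Polynomial ℂ :=
  ∑ j ∈ Finset.range (S.card - 2), Polynomial.C (circleCount S j : ℂ) * Polynomial.X ^ j

lemma circleCount_eq_zero {S : Finset Plane} {j : ℕ} (hj : S.card - 3 < j) :
    circleCount S j = 0 := by
  rw [circleCount, Finset.card_eq_zero, Finset.filter_eq_empty_iff]
  intro T hT h
  obtain ⟨h1, h2⟩ := Finset.mem_powersetCard.1 hT
  have := insideCount_le h1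
  omega

lemma coeff_circlePolynomial {S : Finset Plane} (hn : 4 ≤ S.card) (i : ℕ) :
    (circlePolynomial S).coeff i = circleCount S i := by
  simp only [circlePolynomial, Polynomial.finsetSum_coeff, Polynomial.coeff_C_mul_X_pow]
  simp only [Finset.sum_ite_eq, Finset.mem_range]
  split_ifs with h
  · rfl
  · rw [circleCount_eq_zero (by omega), Nat.cast_zero]

lemma coeff_voronoiPolynomial (S : Finset Plane) (i : ℕ) :
    (voronoiPolynomial S).coeff i =
      if i + 1 ≤ S.card - 1 then (numVoronoiVertices S (i + 1) : ℂ) else 0 := by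
  simp only [voronoiPolynomial, Polynomial.finsetSum_coeff, Polynomial.coeff_C_mul_X_pow]
  have : ∀ k ∈ Finset.Icc 1 (S.card - 1), (if i = k - 1 then (numVoronoiVertices S k : ℂ) else 0) =
      if i + 1 = k then (numVoronoiVertices S k : ℂ) else 0 := by
    intro k hk
    have := (Finset.mem_Icc.1 hk).1
    exact if_congr (by omega) rfl rfl
  rw [Finset.sum_congr rfl this, Finset.sum_ite_eq]
  exact if_congr (by rw [Finset.mem_Icc]; omega) rfl rfl

lemma voronoiPolynomial_eq {S : Finset Plane} (hn : 4 ≤ S.card) (hS : GeneralPosition S) :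
    voronoiPolynomial S = (1 + Polynomial.X) * circlePolynomial S := by
  ext i
  rw [coeff_voronoiPolynomial, add_mul, one_mul, Polynomial.coeff_add, coeff_circlePolynomial hn]
  cases i with
  | zero =>
    rw [if_pos (by omega), Polynomial.coeff_X_mul_zero, add_zero,
      numVoronoiVertices_one hS (by omega)]
  | succ k =>
    rw [Polynomial.coeff_X_mul, coeff_circlePolynomial hn]
    split_ifs with h
    · rw [numVoronoiVertices_succ_succ hS (by omega)]
      push_cast
      rfl
    -- Here `k ≥ S.card - 2`, beyond the largest possible inside count `S.card - 3`.
    · rw [circleCount_eq_zero (by omega), circleCount_eq_zero (by omega)]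
      simp

lemma circlePolynomial_eq_of_convexPosition {S : Finset Plane} (hn : 4 ≤ S.card)
    (hS : GeneralPosition S) (hconv : ConvexPosition S) :
    circlePolynomial S = convexCirclePoly (S.card - 2) := by
  rw [convexPosition_iff] at hconv
  refine Finset.sum_congr rfl fun j hj => ?_
  have hj := Finset.mem_range.1 hj
  rw [circleCount_of_hiddenPoints_eq_empty (S.card - 3) S (by omega) hS hconv j (by omega),
    show S.card - 3 + 1 - j = S.card - 2 - j by omega, Nat.cast_mul, Nat.cast_sub (by omega)]
  push_cast
  rfl

/-- Equal norms of the constant and leading coefficients say `n - 2 + h = n - 2 - h`, where `n`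
counts all points and `h` the hidden ones. -/
lemma convexPosition_of_roots {S : Finset Plane} (hn : 4 ≤ S.card) (hS : GeneralPosition S)
    (h : ∀ z : ℂ, (circlePolynomial S).IsRoot z → ‖z‖ = 1) : ConvexPosition S := by
  rw [convexPosition_iff, ← Finset.card_eq_zero]
  have htop := circleCount_top_pos hn hS
  have hcoeff : (circlePolynomial S).coeff (S.card - 3) ≠ 0 := by
    rw [coeff_circlePolynomial hn]
    exact_mod_cast htop.ne'
  have hne : circlePolynomial S ≠ 0 := by
    intro h0
    rw [h0, Polynomial.coeff_zero] at hcoeff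
    exact hcoeff rfl
  have hdeg : (circlePolynomial S).natDegree = S.card - 3 := by
    refine le_antisymm ?_ (Polynomial.le_natDegree_of_ne_zero hcoeff)
    rw [Polynomial.natDegree_le_iff_coeff_eq_zero]
    intro i hi
    rw [coeff_circlePolynomial hn, circleCount_eq_zero hi, Nat.cast_zero]
  have key := norm_coeff_zero_eq_of_roots hne h
  rw [Polynomial.leadingCoeff, hdeg, coeff_circlePolynomial hn, coeff_circlePolynomial hn,
    Complex.norm_natCast, Complex.norm_natCast, Nat.cast_inj] at key
  obtain ⟨h1, h2⟩ := circleCount_zero_and_top hn hS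
  omega

end VoronoiPoly

end

theorem mainTheorem1 (S : Finset VoronoiPoly.Plane) (hn : 4 ≤ S.card)
    (hS : VoronoiPoly.GeneralPosition S) :
    VoronoiPoly.ConvexPosition S ↔
      ∀ z : ℂ, (VoronoiPoly.voronoiPolynomial S).IsRoot z → ‖z‖ = 1 := by
  rw [VoronoiPoly.voronoiPolynomial_eq hn hS]
  constructor
  · intro hconv z hz
    rw [VoronoiPoly.circlePolynomial_eq_of_convexPosition hn hS hconv] at hz
    rcases Polynomial.root_mul.1 hz with hz | hz
    · have h1 : z = -1 := by
        rw [Polynomial.IsRoot, Polynomial.eval_add, Polynomial.eval_one, Polynomial.eval_X] at hz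
        linear_combination hz
      rw [h1, norm_neg, norm_one]
    · exact VoronoiPoly.norm_eq_one_of_isRoot_convexCirclePoly (by omega) hz
  · intro h
    exact VoronoiPoly.convexPosition_of_roots hn hS fun z hz =>
      h z (Polynomial.root_mul.2 (Or.inr hz))
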